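/- Let $d\ge 3$ be an odd integer, let $F$ be a field of characteristic $0$ and let $q\in F$ be a root of unity of (exact) order $d$ (for instance $F=\Bbbk(q)$ with $\Bbbk$ a field of characteristic $0$). Let $U_q=U_q(sl(2|1))$ be the associative unital $F$-algebra generated by $k_1,k_1^{-1},k_2,k_2^{-1},e_1,e_2,f_1,f_2$ with the relations $$k_1k_1^{-1}=k_1^{-1}k_1=1,\quad k_2k_2^{-1}=k_2^{-1}k_2=1,\quad k_2k_1=k_1k_2,$$ $$e_1k_1=q^{-2}k_1e_1,\quad e_2k_1=qk_1e_2,\quad e_1k_2=qk_2e_1,\quad e_2k_2=k_2e_2,$$ $$k_1f_1=q^{-2}f_1k_1,\quad k_1f_2=qf_2k_1,\quad k_2f_1=qf_1k_2,\quad k_2f_2=f_2k_2,$$ $$e_1f_1=f_1e_1+\frac{k_1-k_1^{-1}}{q-q^{-1}},\quad e_2f_2=-f_2e_2+\frac{k_2-k_2^{-1}}{q-q^{-1}},\quad e_1f_2=f_2e_1,\quad e_2f_1=f_1e_2,\quad e_2^2=f_2^2=0,$$ $$e_1^2e_2-(q+q^{-1})e_1e_2e_1+e_2e_1^2=0,\qquad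 f_1^2f_2-(q+q^{-1})f_1f_2f_1+f_2f_1^2=0.$$ Put $e_3=e_1e_2-q^{-1}e_2e_1$ and $f_3=f_2f_1-qf_1f_2$, and let $\bar U_q=U_q/I$, where $I$ is the two-sided ideal generated by $f_1^d,\ k_1^d-1,\ k_2^d-1,\ e_1^d$. Theorem. The images in $\bar U_q$ of the monomials $$f_1^{w}f_3^{s}f_2^{l}k_1^{i}k_2^{j}e_1^{r}e_3^{h}e_2^{t},\qquad 0\le w,i,j,r\le d-1,\quad s,l,h,t\in\{0,1\},$$ are pairwise distinct and form a basis of $\bar U_q$ over $F$. In particular $\bar U_q$ is finite-dimensional over $F$ and $\dim_F\bar U_q=16d^4$. -/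

import Mathlib

namespace QuantumSl21

/-- The algebra generators `k₁, k₁⁻¹, k₂, k₂⁻¹, e₁, e₂, f₁, f₂`. -/
inductive Gen : Type
  | k1 | k1inv | k2 | k2inv | e1 | e2 | f1 | f2

/-- A generator, as an element of the free unital associative algebra. -/
def gen (F : Type*) [Field F] (g : Gen) : FreeAlgebra F Gen := FreeAlgebra.ι F g

open Gen in
/-- The defining relations of the quantum superalgebra `U_q(sl(2|1))`. -/
inductive Rel (F : Type*) [Field F] (q : F) : FreeAlgebra F Gen → FreeAlgebra F Gen → Prop
  | k1_k1inv : Rel F q (gen F k1 * gen F k1inv) 1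
  | k1inv_k1 : Rel F q (gen F k1inv * gen F k1) 1
  | k2_k2inv : Rel F q (gen F k2 * gen F k2inv) 1
  | k2inv_k2 : Rel F q (gen F k2inv * gen F k2) 1
  | k2_k1 : Rel F q (gen F k2 * gen F k1) (gen F k1 * gen F k2)
  | e1_k1 : Rel F q (gen F e1 * gen F k1) (q⁻¹ ^ 2 • (gen F k1 * gen F e1))
  | e2_k1 : Rel F q (gen F e2 * gen F k1) (q • (gen F k1 * gen F e2))
  | e1_k2 : Rel F q (gen F e1 * gen F k2) (q • (gen F k2 * gen F e1))
  | e2_k2 : Rel F q (gen F e2 * gen F k2) (gen F k2 * gen F e2)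
  | k1_f1 : Rel F q (gen F k1 * gen F f1) (q⁻¹ ^ 2 • (gen F f1 * gen F k1))
  | k1_f2 : Rel F q (gen F k1 * gen F f2) (q • (gen F f2 * gen F k1))
  | k2_f1 : Rel F q (gen F k2 * gen F f1) (q • (gen F f1 * gen F k2))
  | k2_f2 : Rel F q (gen F k2 * gen F f2) (gen F f2 * gen F k2)
  | e1_f1 : Rel F q (gen F e1 * gen F f1)
      (gen F f1 * gen F e1 + (q - q⁻¹)⁻¹ • (gen F k1 - gen F k1inv))
  | e2_f2 : Rel F q (gen F e2 * gen F f2)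
      (-(gen F f2 * gen F e2) + (q - q⁻¹)⁻¹ • (gen F k2 - gen F k2inv))
  | e1_f2 : Rel F q (gen F e1 * gen F f2) (gen F f2 * gen F e1)
  | e2_f1 : Rel F q (gen F e2 * gen F f1) (gen F f1 * gen F e2)
  | e2_sq : Rel F q (gen F e2 ^ 2) 0
  | f2_sq : Rel F q (gen F f2 ^ 2) 0
  | serre_e : Rel F q
      (gen F e1 ^ 2 * gen F e2 - (q + q⁻¹) • (gen F e1 * gen F e2 * gen F e1)
        + gen F e2 * gen F e1 ^ 2) 0
  | serre_f : Rel F q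
      (gen F f1 ^ 2 * gen F f2 - (q + q⁻¹) • (gen F f1 * gen F f2 * gen F f1)
        + gen F f2 * gen F f1 ^ 2) 0

/-- The unital associative algebra `U_q = U_q(sl(2|1))` over `F`, given by generators and
relations. -/
abbrev U (F : Type*) [Field F] (q : F) : Type _ := RingQuot (Rel F q)

section Elements

variable (F : Type*) [Field F] (q : F)

/-- The class of a generator in `U_q`. -/
def uGen (g : Gen) : U F q := RingQuot.mkAlgHom F (Rel F q) (gen F g)

def k₁ : U F q := uGen F q Gen.k1

def k₂ : U F q := uGen F q Gen.k2

def e₁ : U F q := uGen F q Gen.e1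

def e₂ : U F q := uGen F q Gen.e2

def f₁ : U F q := uGen F q Gen.f1

def f₂ : U F q := uGen F q Gen.f2

/-- `e₃ = e₁ e₂ - q⁻¹ e₂ e₁`. -/
def e₃ : U F q := e₁ F q * e₂ F q - q⁻¹ • (e₂ F q * e₁ F q)

/-- `f₃ = f₂ f₁ - q f₁ f₂`. -/
def f₃ : U F q := f₂ F q * f₁ F q - q • (f₁ F q * f₂ F q)

/-- The two-sided ideal `(f₁ᵈ, k₁ᵈ - 1, k₂ᵈ - 1, e₁ᵈ)` of `U_q`. -/
def I (d : ℕ) : TwoSidedIdeal (U F q) :=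
  TwoSidedIdeal.span {f₁ F q ^ d, k₁ F q ^ d - 1, k₂ F q ^ d - 1, e₁ F q ^ d}

/-- The quotient algebra `Ū_q` of `U_q` by the two-sided ideal `(f₁ᵈ, k₁ᵈ - 1, k₂ᵈ - 1, e₁ᵈ)`. -/
abbrev UBar (d : ℕ) : Type _ := (I F q d).ringCon.Quotient

/-- The canonical projection `U_q → Ū_q`. -/
def proj (d : ℕ) : U F q →ₐ[F] UBar F q d := RingCon.mkₐ F (I F q d).ringCon

end Elements

end QuantumSl21

/-!
The subalgebras generated by the `fᵢ`, the `kᵢ` and the `eᵢ` multiply to all of `Ū_q`, since every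
`eᵢ` and `kᵢ` can be moved to the right past the `fⱼ` at the cost of a term in the `k`'s. Each of
the three is spanned by ordered monomials: the `q`-commutator of a pair `(a, b)` satisfying the
Serre relation and `b² = 0` `q`-commutes with both `a` and `b` and, if `q² ≠ -1`, has square `0`.

For linear independence, a module `X` over the nonnegative part is induced to a `Ū_q`-module with
underlying space the tensor product of `X` with the span of the symbols `f₁ʷ f₃ˢ f₂ˡ`. The action
is given by explicit formulas, from which the relations between the generators of opposite sign
can be read off. The remaining relations, those among the `eᵢ`, need no computation: they commute
up to sign with the `fᵢ` and vanish on `X`. The pair `(f₁, f₂)` on the module induced from `F`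
obeys the relations required of `(e₁, e₂)`, so functions on `(ℤ/d)²` with values in that space are
a copy of the regular representation of the nonnegative part. On the module induced from it, the
monomials send the standard generating vector to distinct vectors of the standard basis.
-/

namespace QuantumSl21

/-! ### Subalgebras generated by a set -/

section Adjoin

variable {R A : Type*} [CommSemiring R] [Semiring A] [Algebra R A] {G : Set A}

open Algebra Submodule

theorem adjoin_le_of_mul_mem {N : Submodule R A} (h1 : 1 ∈ N)
    (hN : ∀ g ∈ G, ∀ x ∈ N, g * x ∈ N) : Subalgebra.toSubmodule (adjoin R G) ≤ N := by
  intro a ha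
  suffices h : ∀ x ∈ N, a * x ∈ N by simpa using h 1 h1
  induction ha using adjoin_induction with
  | mem g hg => exact hN g hg
  | algebraMap c => exact fun x hx => by simpa only [Algebra.smul_def] using N.smul_mem c hx
  | add a b _ _ ha hb =>
    exact fun x hx => by simpa only [add_mul] using N.add_mem (ha x hx) (hb x hx)
  | mul a b _ _ ha hb => exact fun x hx => by simpa only [mul_assoc] using ha _ (hb x hx)

theorem mul_mem_span_of_forall_mul_mem {s : Set A} {N : Submodule R A} {g x : A}
    (h : ∀ y ∈ s, g * y ∈ N) (hx : x ∈ span R s) : g * x ∈ N := by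
  have hs : span R s ≤ N.comap (LinearMap.mulLeft R g) := span_le.2 h
  exact hs hx

theorem mul_mem_span_range {ι : Type*} {v : ι → A} {g : A}
    (h : ∀ i, g * v i ∈ span R (Set.range v)) :
    ∀ x ∈ span R (Set.range v), g * x ∈ span R (Set.range v) :=
  fun _ => mul_mem_span_of_forall_mul_mem (Set.forall_mem_range.2 h)

theorem mul_adjoin_le {V : Submodule R A}
    (h : ∀ v ∈ V, ∀ g ∈ G, v * g ∈ Subalgebra.toSubmodule (adjoin R G) * V) :
    V * Subalgebra.toSubmodule (adjoin R G) ≤ Subalgebra.toSubmodule (adjoin R G) * V := by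
  set S := Subalgebra.toSubmodule (adjoin R G)
  have hSS : S * S = S := (adjoin R G).isIdempotentElem_toSubmodule
  refine mul_le.2 fun v hv a ha => ?_
  induction ha using adjoin_induction generalizing v with
  | mem g hg => exact h v hv g hg
  | algebraMap c =>
    rw [← Algebra.commutes]
    exact mul_mem_mul ((adjoin R G).algebraMap_mem c) hv
  | add a b _ _ ha hb => simpa only [mul_add] using add_mem (ha v hv) (hb v hv)
  | mul a b _ _ ha hb =>
    have hb' : S * V ≤ (S * V).comap (LinearMap.mulRight R b) := mul_le.2 fun s hs v hv => by
      rw [mem_comap, LinearMap.mulRight_apply, mul_assoc, ← hSS, mul_assoc S]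
      exact mul_mem_mul hs (hb v hv)
    rw [← mul_assoc]
    exact hb' (ha v hv)

theorem adjoin_mul_le {V : Submodule R A}
    (h : ∀ g ∈ G, ∀ v ∈ V, g * v ∈ V * Subalgebra.toSubmodule (adjoin R G)) :
    Subalgebra.toSubmodule (adjoin R G) * V ≤ V * Subalgebra.toSubmodule (adjoin R G) := by
  set S := Subalgebra.toSubmodule (adjoin R G)
  have hSS : S * S = S := (adjoin R G).isIdempotentElem_toSubmodule
  refine mul_le.2 fun a ha v hv => ?_
  induction ha using adjoin_induction generalizing v with
  | mem g hg => exact h g hg v hv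
  | algebraMap c =>
    rw [Algebra.commutes]
    exact mul_mem_mul hv ((adjoin R G).algebraMap_mem c)
  | add a b _ _ ha hb => simpa only [add_mul] using add_mem (ha v hv) (hb v hv)
  | mul a b _ _ ha hb =>
    have ha' : V * S ≤ (V * S).comap (LinearMap.mulLeft R a) := mul_le.2 fun v hv s hs => by
      rw [mem_comap, LinearMap.mulLeft_apply, ← mul_assoc, ← hSS, ← mul_assoc V]
      exact mul_mem_mul (ha v hv) hs
    rw [mul_assoc]
    exact ha' (hb v hv)

theorem adjoin_comm_pair_le_span {d : ℕ} [NeZero d] {a b : A} (ha : a ^ d = 1) (hb : b ^ d = 1)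
    (hab : Commute a b) :
    Subalgebra.toSubmodule (adjoin R {a, b}) ≤
      span R (Set.range fun p : Fin d × Fin d => a ^ (p.1 : ℕ) * b ^ (p.2 : ℕ)) := by
  have hmem (i j : ℕ) : a ^ i * b ^ j ∈
      span R (Set.range fun p : Fin d × Fin d => a ^ (p.1 : ℕ) * b ^ (p.2 : ℕ)) := by
    rw [pow_eq_pow_mod i ha, pow_eq_pow_mod j hb]
    exact subset_span ⟨(⟨i % d, i.mod_lt (NeZero.pos d)⟩, ⟨j % d, j.mod_lt (NeZero.pos d)⟩), rfl⟩
  refine adjoin_le_of_mul_mem (by simpa using hmem 0 0) ?_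
  rintro _ (rfl | rfl)
  · exact mul_mem_span_range fun p => by simpa only [← mul_assoc, ← pow_succ'] using hmem _ _
  · refine mul_mem_span_range fun p => ?_
    rw [← mul_assoc, ← (hab.pow_left p.1).eq, mul_assoc, ← pow_succ']
    exact hmem _ _

end Adjoin

/-! ### Serre pairs -/

section SerrePair

variable {F : Type*} [Field F] (q : F) {A : Type*} [Ring A] [Algebra F A] (a b : A)

/-- The left-hand side of the quantum Serre relation between `a` and `b`. -/
def serre : A := a ^ 2 * b - (q + q⁻¹) • (a * b * a) + b * a ^ 2

/-- The `q`-commutator of a Serre pair. It is `f₃` for the pair `(f₁, f₂)` and `-q e₃` for the pair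
`(e₁, e₂)`. -/
def rootVector : A := b * a - q • (a * b)

/-- The ordered monomials in `a`, the root vector and `b`. -/
def serreMonomial (w s l : ℕ) : A := a ^ w * rootVector q a b ^ s * b ^ l

/-- The relations between `f₁` and `f₂`, and between `e₁` and `e₂`, in `Ū_q`. -/
structure IsSerrePair (d : ℕ) : Prop where
  pow_eq_zero : a ^ d = 0
  sq_eq_zero : b ^ 2 = 0
  serre_eq_zero : serre q a b = 0

variable {q} {a b} {d : ℕ}

theorem map_serreMonomial {B : Type*} [Ring B] [Algebra F B] (φ : A →ₐ[F] B) (w s l : ℕ) :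
    φ (serreMonomial q a b w s l) = serreMonomial q (φ a) (φ b) w s l := by
  simp only [serreMonomial, rootVector, map_mul, map_pow, map_sub, map_smul]

theorem pow_apply_of_forall_apply {X Y : Type*} [AddCommGroup X] [Module F X] [AddCommGroup Y]
    [Module F Y] {T : X →ₗ[F] Y} {a : Module.End F X} {a' : Module.End F Y} {α : F}
    (ha : ∀ x, T (a x) = α • a' (T x)) (n : ℕ) (x : X) :
    T ((a ^ n) x) = α ^ n • (a' ^ n) (T x) := by
  induction n with
  | zero => simp
  | succ n ih =>
    simp only [pow_succ', Module.End.mul_apply, ha, ih, map_smul, smul_smul]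

theorem serre_apply_of_forall_apply {X Y : Type*} [AddCommGroup X] [Module F X]
    [AddCommGroup Y] [Module F Y] {T : X →ₗ[F] Y} {a b : Module.End F X} {a' b' : Module.End F Y}
    {α β : F} (ha : ∀ x, T (a x) = α • a' (T x)) (hb : ∀ x, T (b x) = β • b' (T x)) (x : X) :
    T (serre q a b x) = (α ^ 2 * β) • serre q a' b' (T x) := by
  simp only [serre, pow_two, LinearMap.add_apply, LinearMap.sub_apply, LinearMap.smul_apply,
    Module.End.mul_apply, map_add, map_sub, map_smul, ha, hb]
  module

theorem serreMonomial_apply_of_forall_apply {X Y : Type*} [AddCommGroup X] [Module F X]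
    [AddCommGroup Y] [Module F Y] {T : X →ₗ[F] Y} {a b : Module.End F X} {a' b' : Module.End F Y}
    {α β : F} (ha : ∀ x, T (a x) = α • a' (T x)) (hb : ∀ x, T (b x) = β • b' (T x))
    (w s l : ℕ) (x : X) : T (serreMonomial q a b w s l x) =
      (α ^ w * (α * β) ^ s * β ^ l) • serreMonomial q a' b' w s l (T x) := by
  have hc (x : X) : T (rootVector q a b x) = (α * β) • rootVector q a' b' (T x) := by
    simp only [rootVector, LinearMap.sub_apply, LinearMap.smul_apply, Module.End.mul_apply,
      map_sub, map_smul, ha, hb]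
    module
  simp only [serreMonomial, Module.End.mul_apply, pow_apply_of_forall_apply ha,
    pow_apply_of_forall_apply hb, pow_apply_of_forall_apply hc, map_smul, smul_smul]
  ring_nf

theorem rootVector_mul_left (hq0 : q ≠ 0) (hs : serre q a b = 0) :
    rootVector q a b * a = q⁻¹ • (a * rootVector q a b) := by
  rw [← sub_eq_zero, ← hs]
  simp only [serre, rootVector, sub_mul, mul_sub, smul_mul_assoc, mul_smul_comm, pow_two,
    mul_assoc]
  match_scalars <;> field_simp
  ring

theorem mul_rootVector (hb : b ^ 2 = 0) :
    b * rootVector q a b = -(q • (rootVector q a b * b)) := by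
  rw [pow_two] at hb
  simp [rootVector, sub_mul, mul_sub, mul_assoc, ← mul_assoc b b, hb]

theorem mul_eq_smul_add_rootVector : b * a = q • (a * b) + rootVector q a b := by
  rw [rootVector, add_sub_cancel]

/-- Moving one factor `c = b a - q a b` of `c²` past `a` and `b` shows `c² = -q⁻² c²`. -/
theorem rootVector_sq (hq0 : q ≠ 0) (hq : q ^ 2 + 1 ≠ 0) (hs : serre q a b = 0)
    (hb : b ^ 2 = 0) : rootVector q a b ^ 2 = 0 := by
  set c := rootVector q a b
  have hca : c * a = q⁻¹ • (a * c) := rootVector_mul_left hq0 hs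
  have hcb : c * b = -(q⁻¹ • (b * c)) := by
    rw [mul_rootVector hb, smul_neg, inv_smul_smul₀ hq0, neg_neg]
  have hcc : c * c = -(q⁻¹ ^ 2 • (c * c)) := calc
    c * c = c * (b * a - q • (a * b)) := rfl
    _ = c * b * a - q • (c * a * b) := by rw [mul_sub, mul_smul_comm, mul_assoc, mul_assoc]
    _ = -(q⁻¹ ^ 2 • ((b * a - q • (a * b)) * c)) := by
      rw [hcb, hca]
      simp only [neg_mul, smul_mul_assoc, mul_assoc, hca, hcb, mul_smul_comm, mul_neg, sub_mul]
      module
  have h : (q ^ 2 + 1) • (c * c) = 0 := by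
    rw [add_smul, one_smul]
    nth_rewrite 1 [hcc]
    rw [smul_neg, smul_smul, ← mul_pow, mul_inv_cancel₀ hq0, one_pow, one_smul, neg_add_cancel]
  rw [pow_two]
  exact (smul_eq_zero.1 h).resolve_left hq

namespace IsSerrePair

open Submodule

theorem serreMonomial_mem_span (h : IsSerrePair q a b d) (w : ℕ) (s l : Fin 2) :
    serreMonomial q a b w s l ∈
      span F (Set.range fun p : Fin d × Fin 2 × Fin 2 => serreMonomial q a b p.1 p.2.1 p.2.2) := by
  by_cases hw : w < d
  · exact subset_span ⟨(⟨w, hw⟩, s, l), rfl⟩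
  · rw [serreMonomial, pow_eq_zero_of_le (not_lt.1 hw) h.pow_eq_zero, zero_mul, zero_mul]
    exact zero_mem _

theorem mul_left_mem_span (h : IsSerrePair q a b d) : ∀ x ∈
    span F (Set.range fun p : Fin d × Fin 2 × Fin 2 => serreMonomial q a b p.1 p.2.1 p.2.2),
    a * x ∈ span F (Set.range fun p : Fin d × Fin 2 × Fin 2 =>
      serreMonomial q a b p.1 p.2.1 p.2.2) :=
  mul_mem_span_range fun p => by
    simpa only [serreMonomial, ← mul_assoc, ← pow_succ'] using
      h.serreMonomial_mem_span (p.1 + 1) p.2.1 p.2.2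

theorem rootVector_mul_serreMonomial_mem_span (h : IsSerrePair q a b d) (hq0 : q ≠ 0)
    (hq : q ^ 2 + 1 ≠ 0) (w : ℕ) (s l : Fin 2) : rootVector q a b * serreMonomial q a b w s l ∈
      span F (Set.range fun p : Fin d × Fin 2 × Fin 2 => serreMonomial q a b p.1 p.2.1 p.2.2) := by
  induction w with
  | zero =>
    fin_cases s
    · simpa [serreMonomial] using h.serreMonomial_mem_span 0 1 l
    · simp [serreMonomial, ← mul_assoc, ← pow_two,
        rootVector_sq hq0 hq h.serre_eq_zero h.sq_eq_zero]
  | succ w ih =>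
    have : rootVector q a b * serreMonomial q a b (w + 1) s l =
        q⁻¹ • (a * (rootVector q a b * serreMonomial q a b w s l)) := by
      simp only [serreMonomial, pow_succ' a, ← mul_assoc,
        rootVector_mul_left hq0 h.serre_eq_zero, smul_mul_assoc]
    exact this ▸ smul_mem _ _ (h.mul_left_mem_span _ ih)

theorem mul_serreMonomial_mem_span (h : IsSerrePair q a b d) (hq0 : q ≠ 0) (hq : q ^ 2 + 1 ≠ 0)
    (w : ℕ) (s l : Fin 2) : b * serreMonomial q a b w s l ∈
      span F (Set.range fun p : Fin d × Fin 2 × Fin 2 => serreMonomial q a b p.1 p.2.1 p.2.2) := by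
  have hbb : b * b = 0 := by rw [← pow_two, h.sq_eq_zero]
  induction w with
  | zero =>
    have hbc := mul_rootVector (q := q) (a := a) h.sq_eq_zero
    fin_cases s <;> fin_cases l
    · simpa [serreMonomial] using h.serreMonomial_mem_span 0 0 1
    · simp [serreMonomial, hbb]
    · simpa [serreMonomial, hbc] using smul_mem _ q (h.serreMonomial_mem_span 0 1 1)
    · simp [serreMonomial, ← mul_assoc, hbc, mul_assoc _ b, hbb]
  | succ w ih =>
    have : b * serreMonomial q a b (w + 1) s l = q • (a * (b * serreMonomial q a b w s l)) +
        rootVector q a b * serreMonomial q a b w s l := by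
      simp only [serreMonomial, pow_succ' a, ← mul_assoc, ← smul_mul_assoc, ← add_mul,
        mul_eq_smul_add_rootVector (q := q) (a := a)]
    exact this ▸ add_mem (smul_mem _ _ (h.mul_left_mem_span _ ih))
      (h.rootVector_mul_serreMonomial_mem_span hq0 hq _ _ _)

theorem adjoin_le_span (h : IsSerrePair q a b d) (hq0 : q ≠ 0) (hq : q ^ 2 + 1 ≠ 0) :
    Subalgebra.toSubmodule (Algebra.adjoin F {a, b}) ≤
      span F (Set.range fun p : Fin d × Fin 2 × Fin 2 => serreMonomial q a b p.1 p.2.1 p.2.2) := by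
  refine adjoin_le_of_mul_mem (by simpa [serreMonomial] using h.serreMonomial_mem_span 0 0 0) ?_
  rintro _ (rfl | rfl)
  · exact h.mul_left_mem_span
  · exact mul_mem_span_range fun p => h.mul_serreMonomial_mem_span hq0 hq _ _ _

end IsSerrePair

end SerrePair

/-! ### Realizations of the relations -/

section Realization

variable {F : Type*} [Field F]

/-- Elements of an algebra subject to the relations of `U_q` between the `kᵢ` and the `eⱼ`. The
`kᵢ` are units, so that no separate data are needed for their inverses. -/
structure BorelData (q : F) (A : Type*) [Ring A] [Algebra F A] where
  k₁ : Aˣ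
  k₂ : Aˣ
  e₁ : A
  e₂ : A
  k₁_k₂ : Commute k₁ k₂
  e₁_k₁ : e₁ * k₁ = q⁻¹ ^ 2 • (k₁ * e₁)
  e₂_k₁ : e₂ * k₁ = q • (k₁ * e₂)
  e₁_k₂ : e₁ * k₂ = q • (k₂ * e₁)
  e₂_k₂ : e₂ * k₂ = k₂ * e₂

/-- Elements of an algebra that realize the nonnegative part of `Ū_q`. -/
structure BorelRealization (q : F) (d : ℕ) (A : Type*) [Ring A] [Algebra F A] extends
    BorelData q A where
  k₁_pow : k₁ ^ d = 1
  k₂_pow : k₂ ^ d = 1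
  e_pair : IsSerrePair q e₁ e₂ d

/-- Elements of an algebra subject to the relations of `U_q`, except for those that involve only
the `eᵢ` or only the `fᵢ`. -/
structure PreRealization (q : F) (A : Type*) [Ring A] [Algebra F A] extends BorelData q A where
  f₁ : A
  f₂ : A
  k₁_f₁ : k₁ * f₁ = q⁻¹ ^ 2 • (f₁ * k₁)
  k₁_f₂ : k₁ * f₂ = q • (f₂ * k₁)
  k₂_f₁ : k₂ * f₁ = q • (f₁ * k₂)
  k₂_f₂ : k₂ * f₂ = f₂ * k₂
  e₁_f₁ : e₁ * f₁ = f₁ * e₁ + (q - q⁻¹)⁻¹ • (k₁ - (k₁⁻¹ : Aˣ) : A)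
  e₂_f₂ : e₂ * f₂ = -(f₂ * e₂) + (q - q⁻¹)⁻¹ • (k₂ - (k₂⁻¹ : Aˣ) : A)
  e₁_f₂ : e₁ * f₂ = f₂ * e₁
  e₂_f₁ : e₂ * f₁ = f₁ * e₂

/-- Elements of an algebra that realize `Ū_q`. -/
structure Realization (q : F) (d : ℕ) (A : Type*) [Ring A] [Algebra F A] extends
    PreRealization q A, BorelRealization q d A where
  f_pair : IsSerrePair q f₁ f₂ d

variable {q : F} {A : Type*} [Ring A] [Algebra F A]

theorem mul_units_inv_eq_smul {a : F} (ha : a ≠ 0) {e : A} {k : Aˣ} (h : e * k = a • (k * e)) :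
    e * (k⁻¹ : Aˣ) = a⁻¹ • ((k⁻¹ : Aˣ) * e) := by
  rw [eq_inv_smul_iff₀ ha, ← Units.mul_right_inj k, mul_smul_comm, ← mul_assoc, ← smul_mul_assoc,
    ← h, Units.mul_inv_cancel_right, Units.mul_inv_cancel_left]

theorem mul_mul_of_mul_eq {x y z : A} (h : x * y = z) (w : A) : x * (y * w) = z * w := by
  rw [← mul_assoc, h]

namespace BorelData

variable (B : BorelData q A)

theorem e₁_k₁_inv (hq0 : q ≠ 0) : B.e₁ * (B.k₁⁻¹ : Aˣ) = q ^ 2 • ((B.k₁⁻¹ : Aˣ) * B.e₁) := by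
  simpa using mul_units_inv_eq_smul (pow_ne_zero 2 (inv_ne_zero hq0)) B.e₁_k₁

theorem e₂_k₁_inv (hq0 : q ≠ 0) : B.e₂ * (B.k₁⁻¹ : Aˣ) = q⁻¹ • ((B.k₁⁻¹ : Aˣ) * B.e₂) :=
  mul_units_inv_eq_smul hq0 B.e₂_k₁

theorem e₁_k₂_inv (hq0 : q ≠ 0) : B.e₁ * (B.k₂⁻¹ : Aˣ) = q⁻¹ • ((B.k₂⁻¹ : Aˣ) * B.e₁) :=
  mul_units_inv_eq_smul hq0 B.e₁_k₂

theorem e₂_k₂_inv : B.e₂ * (B.k₂⁻¹ : Aˣ) = (B.k₂⁻¹ : Aˣ) * B.e₂ :=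
  Commute.units_inv_right (show Commute B.e₂ B.k₂ from B.e₂_k₂)

end BorelData

namespace PreRealization

variable (R : PreRealization q A)

theorem e₂_sq_mul_f₂ : R.e₂ ^ 2 * R.f₂ = R.f₂ * R.e₂ ^ 2 := by
  simp only [pow_two, mul_assoc, R.e₂_f₂, mul_mul_of_mul_eq R.e₂_f₂, mul_add, add_mul, mul_sub,
    sub_mul, mul_smul_comm, smul_mul_assoc, mul_neg, neg_mul, R.e₂_k₂, R.e₂_k₂_inv]
  module

theorem serre_mul_f₁ (hq0 : q ≠ 0) : serre q R.e₁ R.e₂ * R.f₁ = R.f₁ * serre q R.e₁ R.e₂ := by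
  simp only [serre, pow_two, mul_assoc, R.e₁_f₁, mul_mul_of_mul_eq R.e₁_f₁, R.e₂_f₁,
    mul_mul_of_mul_eq R.e₂_f₁, mul_add, mul_sub, add_mul, sub_mul, mul_smul_comm, smul_mul_assoc,
    R.e₁_k₁, mul_mul_of_mul_eq R.e₁_k₁, R.e₁_k₁_inv hq0, mul_mul_of_mul_eq (R.e₁_k₁_inv hq0),
    R.e₂_k₁, mul_mul_of_mul_eq R.e₂_k₁, R.e₂_k₁_inv hq0, mul_mul_of_mul_eq (R.e₂_k₁_inv hq0)]
  match_scalars <;> field_simp <;> ring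

theorem serre_mul_f₂ (hq0 : q ≠ 0) : serre q R.e₁ R.e₂ * R.f₂ = -(R.f₂ * serre q R.e₁ R.e₂) := by
  simp only [serre, pow_two, mul_assoc, R.e₁_f₂, mul_mul_of_mul_eq R.e₁_f₂, R.e₂_f₂,
    mul_mul_of_mul_eq R.e₂_f₂, mul_add, mul_sub, add_mul, sub_mul, mul_smul_comm, smul_mul_assoc,
    neg_mul, mul_neg, R.e₁_k₂, mul_mul_of_mul_eq R.e₁_k₂, R.e₁_k₂_inv hq0,
    mul_mul_of_mul_eq (R.e₁_k₂_inv hq0)]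
  match_scalars <;> field_simp <;> ring

theorem e₁_pow_succ_mul_f₁ (hq0 : q ≠ 0) (n : ℕ) : R.e₁ ^ (n + 1) * R.f₁ =
    R.f₁ * R.e₁ ^ (n + 1) + (q - q⁻¹)⁻¹ •
      ((∑ i ∈ Finset.range (n + 1), (q⁻¹ ^ 2) ^ i) • (R.k₁ * R.e₁ ^ n) -
        (∑ i ∈ Finset.range (n + 1), (q ^ 2) ^ i) • ((R.k₁⁻¹ : Aˣ) * R.e₁ ^ n)) := by
  induction n with
  | zero => simpa using R.e₁_f₁
  | succ n ih =>
    rw [pow_succ' R.e₁ (n + 1), mul_assoc, ih, geom_sum_succ (n := n + 1),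
      geom_sum_succ (n := n + 1), mul_add, ← mul_assoc R.e₁ R.f₁, R.e₁_f₁]
    simp only [mul_sub, mul_smul_comm, mul_mul_of_mul_eq R.e₁_k₁,
      mul_mul_of_mul_eq (R.e₁_k₁_inv hq0), add_mul, smul_mul_assoc, sub_mul, mul_assoc,
      pow_succ' R.e₁ n]
    module

theorem e₁_pow_mul_f₁ (hq0 : q ≠ 0) {d : ℕ} (hd : 1 < d) (hq : IsPrimitiveRoot (q ^ 2) d) :
    R.e₁ ^ d * R.f₁ = R.f₁ * R.e₁ ^ d := by
  obtain ⟨n, rfl⟩ : ∃ n, d = n + 1 := ⟨d - 1, by omega⟩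
  rw [R.e₁_pow_succ_mul_f₁ hq0, inv_pow, hq.inv.geom_sum_eq_zero hd, hq.geom_sum_eq_zero hd]
  simp

end PreRealization

end Realization

/-! ### Realizations and homomorphisms out of `Ū_q` -/

section Lift

variable {F : Type*} [Field F] {q : F} {d : ℕ}

variable (F q d) in
/-- The canonical surjection from the free algebra on the generators of `U_q` to `Ū_q`. -/
def freeProj : FreeAlgebra F Gen →ₐ[F] UBar F q d :=
  (proj F q d).comp (RingQuot.mkAlgHom F (Rel F q))

theorem freeProj_surjective : Function.Surjective (freeProj F q d) :=
  (RingCon.mk'_surjective _).comp (RingQuot.mkAlgHom_surjective F (Rel F q))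

variable (F q d) in
theorem freeProj_eq_of_rel {x y : FreeAlgebra F Gen} (h : Rel F q x y) :
    freeProj F q d x = freeProj F q d y :=
  congrArg (proj F q d) (RingQuot.mkAlgHom_rel F h)

variable (d) in
theorem proj_eq_zero {x : U F q}
    (h : x ∈ ({f₁ F q ^ d, k₁ F q ^ d - 1, k₂ F q ^ d - 1, e₁ F q ^ d} : Set (U F q))) :
    proj F q d x = 0 :=
  (I F q d).ringCon.eq.2 (TwoSidedIdeal.subset_span h)

theorem freeProj_gen_f1_pow : freeProj F q d (gen F .f1) ^ d = 0 :=
  (map_pow (proj F q d) (f₁ F q) d).symm.trans (proj_eq_zero d (by simp))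

theorem freeProj_gen_e1_pow : freeProj F q d (gen F .e1) ^ d = 0 :=
  (map_pow (proj F q d) (e₁ F q) d).symm.trans (proj_eq_zero d (by simp))

theorem freeProj_gen_k1_pow : freeProj F q d (gen F .k1) ^ d = 1 := by
  have h := proj_eq_zero d (x := k₁ F q ^ d - 1) (by simp)
  rw [map_sub, map_pow, map_one, sub_eq_zero] at h
  exact h

theorem freeProj_gen_k2_pow : freeProj F q d (gen F .k2) ^ d = 1 := by
  have h := proj_eq_zero d (x := k₂ F q ^ d - 1) (by simp)
  rw [map_sub, map_pow, map_one, sub_eq_zero] at h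
  exact h

namespace Realization

variable {A : Type*} [Ring A] [Algebra F A] (R : Realization q d A)

/-- The element of a realization that stands for a generator of `U_q`. -/
def onGen : Gen → A
  | .k1 => R.k₁
  | .k1inv => (R.k₁⁻¹ : Aˣ)
  | .k2 => R.k₂
  | .k2inv => (R.k₂⁻¹ : Aˣ)
  | .e1 => R.e₁
  | .e2 => R.e₂
  | .f1 => R.f₁
  | .f2 => R.f₂

theorem lift_onGen_eq_of_rel {x y : FreeAlgebra F Gen} (h : Rel F q x y) :
    FreeAlgebra.lift F R.onGen x = FreeAlgebra.lift F R.onGen y := by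
  have hk : (R.k₂ * R.k₁ : A) = R.k₁ * R.k₂ := by exact_mod_cast congrArg Units.val R.k₁_k₂.eq.symm
  have he := R.e_pair.serre_eq_zero
  have hf := R.f_pair.serre_eq_zero
  simp only [serre] at he hf
  cases h <;> simp only [gen, map_mul, map_add, map_sub, map_smul, map_pow, map_neg, map_one,
    map_zero, FreeAlgebra.lift_ι_apply, onGen, Units.mul_inv, Units.inv_mul, hk, R.e₁_k₁, R.e₂_k₁,
    R.e₁_k₂, R.e₂_k₂, R.k₁_f₁, R.k₁_f₂, R.k₂_f₁, R.k₂_f₂, R.e₁_f₁, R.e₂_f₂, R.e₁_f₂, R.e₂_f₁,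
    R.e_pair.sq_eq_zero, R.f_pair.sq_eq_zero, he, hf]

/-- The homomorphism from `U_q` determined by a realization. -/
def liftU : U F q →ₐ[F] A :=
  RingQuot.liftAlgHom F ⟨FreeAlgebra.lift F R.onGen, fun _ _ => R.lift_onGen_eq_of_rel⟩

theorem liftU_uGen (g : Gen) : R.liftU (uGen F q g) = R.onGen g := by
  simp [liftU, uGen, gen]

theorem I_le_ker : (I F q d).ringCon ≤ RingCon.ker R.liftU.toRingHom := by
  have hk₁ : (R.k₁ : A) ^ d = 1 := by rw [← Units.val_pow_eq_pow_val, R.k₁_pow, Units.val_one]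
  have hk₂ : (R.k₂ : A) ^ d = 1 := by rw [← Units.val_pow_eq_pow_val, R.k₂_pow, Units.val_one]
  have h : I F q d ≤ TwoSidedIdeal.ker R.liftU := by
    refine TwoSidedIdeal.span_le.2 ?_
    rintro x (rfl | rfl | rfl | rfl) <;>
      simp [TwoSidedIdeal.mem_ker, QuantumSl21.f₁, QuantumSl21.k₁, QuantumSl21.k₂, QuantumSl21.e₁,
        liftU_uGen, onGen, hk₁, hk₂, R.e_pair.pow_eq_zero, R.f_pair.pow_eq_zero]
  intro x y hxy
  have := (TwoSidedIdeal.mem_ker _).1 (h ((TwoSidedIdeal.rel_iff _ _ _).1 hxy))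
  rwa [map_sub, sub_eq_zero] at this

/-- The homomorphism from `Ū_q` determined by a realization. -/
def lift : UBar F q d →ₐ[F] A := RingCon.liftₐ _ R.liftU R.I_le_ker

theorem lift_freeProj_gen (g : Gen) : R.lift (freeProj F q d (gen F g)) = R.onGen g :=
  R.liftU_uGen g

end Realization

variable (F q d) in
/-- The realization of `Ū_q` in itself. -/
def tautological : Realization q d (UBar F q d) where
  k₁ := ⟨freeProj F q d (gen F .k1), freeProj F q d (gen F .k1inv),
    by simpa using freeProj_eq_of_rel F q d .k1_k1inv,
    by simpa using freeProj_eq_of_rel F q d .k1inv_k1⟩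
  k₂ := ⟨freeProj F q d (gen F .k2), freeProj F q d (gen F .k2inv),
    by simpa using freeProj_eq_of_rel F q d .k2_k2inv,
    by simpa using freeProj_eq_of_rel F q d .k2inv_k2⟩
  e₁ := freeProj F q d (gen F .e1)
  e₂ := freeProj F q d (gen F .e2)
  f₁ := freeProj F q d (gen F .f1)
  f₂ := freeProj F q d (gen F .f2)
  k₁_k₂ := Units.ext (by simpa using (freeProj_eq_of_rel F q d .k2_k1).symm)
  e₁_k₁ := by simpa using freeProj_eq_of_rel F q d .e1_k1
  e₂_k₁ := by simpa using freeProj_eq_of_rel F q d .e2_k1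
  e₁_k₂ := by simpa using freeProj_eq_of_rel F q d .e1_k2
  e₂_k₂ := by simpa using freeProj_eq_of_rel F q d .e2_k2
  k₁_f₁ := by simpa using freeProj_eq_of_rel F q d .k1_f1
  k₁_f₂ := by simpa using freeProj_eq_of_rel F q d .k1_f2
  k₂_f₁ := by simpa using freeProj_eq_of_rel F q d .k2_f1
  k₂_f₂ := by simpa using freeProj_eq_of_rel F q d .k2_f2
  e₁_f₁ := by simpa using freeProj_eq_of_rel F q d .e1_f1
  e₂_f₂ := by simpa using freeProj_eq_of_rel F q d .e2_f2
  e₁_f₂ := by simpa using freeProj_eq_of_rel F q d .e1_f2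
  e₂_f₁ := by simpa using freeProj_eq_of_rel F q d .e2_f1
  k₁_pow := Units.ext freeProj_gen_k1_pow
  k₂_pow := Units.ext freeProj_gen_k2_pow
  e_pair :=
    { pow_eq_zero := freeProj_gen_e1_pow
      sq_eq_zero := by simpa using freeProj_eq_of_rel F q d .e2_sq
      serre_eq_zero := by simpa [serre] using freeProj_eq_of_rel F q d .serre_e }
  f_pair :=
    { pow_eq_zero := freeProj_gen_f1_pow
      sq_eq_zero := by simpa using freeProj_eq_of_rel F q d .f2_sq
      serre_eq_zero := by simpa [serre] using freeProj_eq_of_rel F q d .serre_f }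

theorem adjoin_range_tautological_onGen :
    Algebra.adjoin F (Set.range (tautological F q d).onGen) = ⊤ := by
  have hgen : (tautological F q d).onGen = freeProj F q d ∘ FreeAlgebra.ι F := by
    funext g
    cases g <;> rfl
  rw [hgen, Set.range_comp, ← AlgHom.map_adjoin, FreeAlgebra.adjoin_range_ι, Algebra.map_top,
    (AlgHom.range_eq_top _).2 freeProj_surjective]

end Lift

/-! ### Triangular decomposition -/

section Triangular

variable {F : Type*} [Field F] {q : F} {d : ℕ} {A : Type*} [Ring A] [Algebra F A]

open Submodule

theorem units_inv_mem_of_pow_eq_one {R M : Type*} [Monoid M] [SetLike R M] [SubmonoidClass R M]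
    [NeZero d] {S : R} {k : Mˣ} (hk : k ^ d = 1) (hS : (k : M) ∈ S) : ((k⁻¹ : Mˣ) : M) ∈ S := by
  have : k⁻¹ = k ^ (d - 1) := by
    rw [inv_eq_iff_mul_eq_one, ← pow_succ', Nat.sub_add_cancel NeZero.one_le, hk]
  rw [this, Units.val_pow_eq_pow_val]
  exact pow_mem hS _

namespace Realization

variable (R : Realization q d A)

/-- The subalgebra generated by `f₁` and `f₂`, as a submodule. -/
def negPart : Submodule F A := Subalgebra.toSubmodule (Algebra.adjoin F {R.f₁, R.f₂})

/-- The subalgebra generated by `k₁` and `k₂`, as a submodule. -/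
def torus : Submodule F A := Subalgebra.toSubmodule (Algebra.adjoin F {(R.k₁ : A), (R.k₂ : A)})

/-- The subalgebra generated by `e₁` and `e₂`, as a submodule. -/
def posPart : Submodule F A := Subalgebra.toSubmodule (Algebra.adjoin F {R.e₁, R.e₂})

/-- The span of `f₁` and `f₂`, which generates `negPart`. -/
def negGen : Submodule F A := span F {R.f₁, R.f₂}

/-- The span of `1`, `e₁` and `e₂`, which generates `posPart`. -/
def posGen : Submodule F A := span F {1, R.e₁, R.e₂}

theorem negPart_mul_self : R.negPart * R.negPart = R.negPart :=
  Subalgebra.isIdempotentElem_toSubmodule _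

theorem torus_mul_self : R.torus * R.torus = R.torus := Subalgebra.isIdempotentElem_toSubmodule _

theorem posPart_mul_self : R.posPart * R.posPart = R.posPart :=
  Subalgebra.isIdempotentElem_toSubmodule _

theorem one_mem_negPart : 1 ∈ R.negPart := one_mem (Algebra.adjoin F _)

theorem one_mem_torus : 1 ∈ R.torus := one_mem (Algebra.adjoin F _)

theorem one_mem_posPart : 1 ∈ R.posPart := one_mem (Algebra.adjoin F _)

theorem k₁_mem_torus : (R.k₁ : A) ∈ R.torus := Algebra.subset_adjoin (by simp)

theorem k₂_mem_torus : (R.k₂ : A) ∈ R.torus := Algebra.subset_adjoin (by simp)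

theorem k₁_inv_mem_torus [NeZero d] : ((R.k₁⁻¹ : Aˣ) : A) ∈ R.torus :=
  units_inv_mem_of_pow_eq_one (S := Algebra.adjoin F _) R.k₁_pow R.k₁_mem_torus

theorem k₂_inv_mem_torus [NeZero d] : ((R.k₂⁻¹ : Aˣ) : A) ∈ R.torus :=
  units_inv_mem_of_pow_eq_one (S := Algebra.adjoin F _) R.k₂_pow R.k₂_mem_torus

theorem negGen_le_negPart : R.negGen ≤ R.negPart := span_le.2 Algebra.subset_adjoin

theorem posGen_le_posPart : R.posGen ≤ R.posPart :=
  span_le.2 <| Set.insert_subset R.one_mem_posPart Algebra.subset_adjoin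

theorem torus_mul_negGen_le : R.torus * R.negGen ≤ R.negGen * R.torus := by
  refine adjoin_mul_le fun k hk v hv => mul_mem_span_of_forall_mul_mem ?_ hv
  have hmem {f : A} (hf : f ∈ ({R.f₁, R.f₂} : Set A)) (c : F) :
      c • (f * k) ∈ R.negGen * R.torus :=
    smul_mem _ _ (mul_mem_mul (subset_span hf) (Algebra.subset_adjoin hk))
  rintro f hf
  have hm := hmem hf
  change k * f ∈ R.negGen * R.torus
  rcases hk with rfl | rfl <;> rcases hf with rfl | rfl
  · exact R.k₁_f₁ ▸ hm _
  · exact R.k₁_f₂ ▸ hm _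
  · exact R.k₂_f₁ ▸ hm _
  · simpa [R.k₂_f₂] using hm 1

theorem posGen_mul_torus_le : R.posGen * R.torus ≤ R.torus * R.posGen := by
  refine mul_adjoin_le fun v hv k hk => ?_
  have hspan : R.posGen ≤ (R.torus * R.posGen).comap (LinearMap.mulRight F k) := span_le.2 ?_
  · exact hspan hv
  have hmem {e : A} (he : e ∈ ({1, R.e₁, R.e₂} : Set A)) (c : F) :
      c • (k * e) ∈ R.torus * R.posGen :=
    smul_mem _ _ (mul_mem_mul (Algebra.subset_adjoin hk) (subset_span he))
  intro e he
  have hm := hmem he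
  change e * k ∈ R.torus * R.posGen
  rcases hk with rfl | rfl <;> rcases he with rfl | rfl | rfl
  · simpa using hm 1
  · exact R.e₁_k₁ ▸ hm _
  · exact R.e₂_k₁ ▸ hm _
  · simpa using hm 1
  · exact R.e₁_k₂ ▸ hm _
  · simpa [R.e₂_k₂] using hm 1

theorem posGen_mul_negGen_le [NeZero d] :
    R.posGen * R.negGen ≤ R.negGen * R.posGen ⊔ R.torus := by
  rw [posGen, negGen, span_mul_span]
  refine span_le.2 ?_
  rintro _ ⟨e, he, f, hf, rfl⟩
  have hfe : f * e ∈ R.negGen * R.posGen ⊔ R.torus :=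
    mem_sup_left (mul_mem_mul (subset_span hf) (subset_span he))
  have h₁ := smul_mem _ (q - q⁻¹)⁻¹ (sub_mem R.k₁_mem_torus R.k₁_inv_mem_torus)
  have h₂ := smul_mem _ (q - q⁻¹)⁻¹ (sub_mem R.k₂_mem_torus R.k₂_inv_mem_torus)
  change e * f ∈ R.negGen * R.posGen ⊔ R.torus
  rcases he with rfl | rfl | rfl
  · simpa using hfe
  · rcases hf with rfl | rfl
    · exact R.e₁_f₁ ▸ add_mem hfe (mem_sup_right h₁)
    · exact R.e₁_f₂ ▸ hfe
  · rcases hf with rfl | rfl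
    · exact R.e₂_f₁ ▸ hfe
    · exact R.e₂_f₂ ▸ add_mem (neg_mem hfe) (mem_sup_right h₂)

theorem torus_mul_posGen_mul_negPart_le [NeZero d] :
    R.torus * R.posGen * R.negPart ≤ R.negPart * (R.torus * R.posGen) := by
  have hT : R.torus ≤ R.torus * R.posGen :=
    le_mul_of_one_le_right' (one_le.2 (subset_span (by simp)))
  have hV : R.torus * R.posGen * R.negGen ≤ R.negPart * (R.torus * R.posGen) := calc
    R.torus * R.posGen * R.negGen ≤ R.torus * (R.negGen * R.posGen ⊔ R.torus) :=
      (mul_assoc _ _ _).trans_le (mul_le_mul_right R.posGen_mul_negGen_le _)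
    _ = R.torus * R.negGen * R.posGen ⊔ R.torus := by
      rw [Submodule.mul_sup, torus_mul_self, mul_assoc]
    _ ≤ R.negGen * R.torus * R.posGen ⊔ 1 * (R.torus * R.posGen) :=
      sup_le_sup (mul_le_mul_left R.torus_mul_negGen_le _) (by rwa [one_mul])
    _ ≤ R.negPart * (R.torus * R.posGen) := by
      rw [mul_assoc, ← Submodule.sup_mul]
      exact mul_le_mul_left (sup_le R.negGen_le_negPart (one_le.2 R.one_mem_negPart)) _
  exact mul_adjoin_le (V := R.torus * R.posGen) fun v hv f hf =>
    hV (mul_mem_mul hv (subset_span hf))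

theorem torus_mul_posGen_mul_triangular_le [NeZero d] :
    R.torus * R.posGen * (R.negPart * R.torus * R.posPart) ≤
      R.negPart * R.torus * R.posPart := calc
  R.torus * R.posGen * (R.negPart * R.torus * R.posPart)
    = R.torus * R.posGen * R.negPart * (R.torus * R.posPart) := by simp only [mul_assoc]
  _ ≤ R.negPart * (R.torus * R.posGen) * (R.torus * R.posPart) :=
    mul_le_mul_left R.torus_mul_posGen_mul_negPart_le _
  _ = R.negPart * R.torus * (R.posGen * R.torus) * R.posPart := by simp only [mul_assoc]
  _ ≤ R.negPart * R.torus * (R.torus * R.posGen) * R.posPart :=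
    mul_le_mul_left (mul_le_mul_right R.posGen_mul_torus_le _) _
  _ = R.negPart * (R.torus * R.torus) * (R.posGen * R.posPart) := by simp only [mul_assoc]
  _ ≤ R.negPart * R.torus * (R.posPart * R.posPart) := by
    rw [torus_mul_self]
    exact mul_le_mul_right (mul_le_mul_left R.posGen_le_posPart _) _
  _ = R.negPart * R.torus * R.posPart := by rw [posPart_mul_self]

theorem negPart_mul_triangular_le : R.negPart * (R.negPart * R.torus * R.posPart) ≤
    R.negPart * R.torus * R.posPart := by
  rw [← mul_assoc, ← mul_assoc, negPart_mul_self]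

theorem onGen_mem [NeZero d] (g : Gen) : R.onGen g ∈ R.negGen ∨ R.onGen g ∈ R.torus * R.posGen := by
  have hk {k : A} (hk : k ∈ R.torus) : k ∈ R.torus * R.posGen :=
    mul_one k ▸ mul_mem_mul hk (subset_span (by simp))
  have he {e : A} (he : e ∈ ({1, R.e₁, R.e₂} : Set A)) : e ∈ R.torus * R.posGen :=
    one_mul e ▸ mul_mem_mul R.one_mem_torus (subset_span he)
  cases g
  · exact .inr (hk R.k₁_mem_torus)
  · exact .inr (hk R.k₁_inv_mem_torus)
  · exact .inr (hk R.k₂_mem_torus)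
  · exact .inr (hk R.k₂_inv_mem_torus)
  · exact .inr (he (by simp [onGen]))
  · exact .inr (he (by simp [onGen]))
  · exact .inl (subset_span (by simp [onGen]))
  · exact .inl (subset_span (by simp [onGen]))

theorem adjoin_onGen_le_triangular [NeZero d] :
    Subalgebra.toSubmodule (Algebra.adjoin F (Set.range R.onGen)) ≤
      R.negPart * R.torus * R.posPart := by
  refine adjoin_le_of_mul_mem ?_ (Set.forall_mem_range.2 fun g x hx => ?_)
  · simpa using mul_mem_mul (mul_mem_mul R.one_mem_negPart R.one_mem_torus) R.one_mem_posPart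
  · rcases R.onGen_mem g with hg | hg
    · exact R.negPart_mul_triangular_le (mul_mem_mul (R.negGen_le_negPart hg) hx)
    · exact R.torus_mul_posGen_mul_triangular_le (mul_mem_mul hg hx)

/-- The monomials of a Poincaré–Birkhoff–Witt basis of `Ū_q` in a realization, with
`rootVector q e₁ e₂` in place of its scalar multiple `e₃`. -/
def pbw (p : (Fin d × Fin 2 × Fin 2) × (Fin d × Fin d) × Fin d × Fin 2 × Fin 2) : A :=
  serreMonomial q R.f₁ R.f₂ p.1.1 p.1.2.1 p.1.2.2 * (R.k₁ ^ (p.2.1.1 : ℕ) * R.k₂ ^ (p.2.1.2 : ℕ)) *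
    serreMonomial q R.e₁ R.e₂ p.2.2.1 p.2.2.2.1 p.2.2.2.2

theorem adjoin_onGen_le_span_pbw [NeZero d] (hq0 : q ≠ 0) (hq : q ^ 2 + 1 ≠ 0) :
    Subalgebra.toSubmodule (Algebra.adjoin F (Set.range R.onGen)) ≤
      span F (Set.range R.pbw) := by
  have hk := adjoin_comm_pair_le_span (R := F) (congrArg Units.val R.k₁_pow)
    (congrArg Units.val R.k₂_pow) (R.k₁_k₂.map (Units.coeHom A))
  refine R.adjoin_onGen_le_triangular.trans ((mul_le_mul' (mul_le_mul'
    (R.f_pair.adjoin_le_span hq0 hq) hk) (R.e_pair.adjoin_le_span hq0 hq)).trans ?_)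
  rw [span_mul_span, span_mul_span]
  refine span_mono ?_
  rintro _ ⟨_, ⟨_, ⟨p, rfl⟩, _, ⟨p', rfl⟩, rfl⟩, _, ⟨p'', rfl⟩, rfl⟩
  exact ⟨(p, p', p''), rfl⟩

end Realization

theorem span_tautological_pbw [NeZero d] (hq0 : q ≠ 0) (hq : q ^ 2 + 1 ≠ 0) :
    ⊤ ≤ span F (Set.range (tautological F q d).pbw) := by
  simpa only [adjoin_range_tautological_onGen, Algebra.top_toSubmodule] using
    (tautological F q d).adjoin_onGen_le_span_pbw hq0 hq

theorem Realization.lift_tautological_pbw (R : Realization q d A)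
    (p : (Fin d × Fin 2 × Fin 2) × (Fin d × Fin d) × Fin d × Fin 2 × Fin 2) :
    R.lift ((tautological F q d).pbw p) = R.pbw p := by
  simp only [pbw, map_mul, map_pow, map_serreMonomial]
  simp only [tautological, lift_freeProj_gen, onGen]

end Triangular

theorem sub_inv_ne_zero {F : Type*} [Field F] {q : F} {d : ℕ} (hd : 1 < d) (hq0 : q ≠ 0)
    (hq2 : IsPrimitiveRoot (q ^ 2) d) : q - q⁻¹ ≠ 0 := fun h =>
  hq2.ne_one hd (by rw [pow_two, ← mul_inv_cancel₀ hq0, ← sub_eq_zero.1 h])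

/-! ### The module induced from the nonnegative part -/

section Induced

variable {F : Type*} [Field F] (q : F) (d : ℕ) (X : Type*) [AddCommGroup X] [Module F X]
  {Y : Type*} [AddCommGroup Y] [Module F Y]

/-- The symmetric `q`-integer `[n]`. -/
def qInt (n : ℕ) : F := (q ^ n - (q ^ n)⁻¹) / (q - q⁻¹)

/-- The free module on the symbols `f₁ʷ f₃ˢ f₂ˡ` with coefficients in `X`. It underlies the
`Ū_q`-module induced from a module `X` over the nonnegative part. -/
abbrev Induced : Type _ := Fin d × Fin 2 × Fin 2 → X

namespace Induced

variable {X}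

variable (F) in
/-- The vector `f₁ʷ f₃ˢ f₂ˡ ⊗ x`, which vanishes when `d ≤ w`. -/
def mono (w : ℕ) (s l : Fin 2) : X →ₗ[F] Induced d X :=
  if h : w < d then LinearMap.single F (fun _ => X) (⟨w, h⟩, s, l) else 0

/-- The linear map out of `Induced d X` with prescribed values on the vectors `mono F d w s l x`
with `w < d`. -/
def lift (g : ℕ → Fin 2 → Fin 2 → X →ₗ[F] Y) : Induced d X →ₗ[F] Y :=
  LinearMap.lsum F (fun _ => X) F fun p => g p.1 p.2.1 p.2.2

variable {d}

theorem mono_of_le {w : ℕ} (h : d ≤ w) (s l : Fin 2) : mono F (X := X) d w s l = 0 :=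
  dif_neg (not_lt.2 h)

theorem mono_val (p : Fin d × Fin 2 × Fin 2) (x : X) :
    mono F d p.1 p.2.1 p.2.2 x = Pi.single p x := by
  simp [mono]

theorem lift_mono {g : ℕ → Fin 2 → Fin 2 → X →ₗ[F] Y} (hg : ∀ w s l, d ≤ w → g w s l = 0)
    (w : ℕ) (s l : Fin 2) (x : X) : lift d g (mono F d w s l x) = g w s l x := by
  by_cases h : w < d
  · simp only [mono, dif_pos h, lift]
    exact LinearMap.lsum_piSingle F (φ := fun _ => X) F _ _ x
  · rw [mono_of_le (not_lt.1 h), hg _ _ _ (not_lt.1 h), LinearMap.zero_apply,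
      LinearMap.zero_apply, map_zero]

theorem hom_ext {f g : Induced d X →ₗ[F] Y}
    (h : ∀ w s l x, f (mono F d w s l x) = g (mono F d w s l x)) : f = g :=
  LinearMap.pi_ext' fun p => LinearMap.ext fun x => by
    simpa only [mono_val, LinearMap.comp_apply, LinearMap.single_apply] using h p.1 p.2.1 p.2.2 x

/-! ### The action of the `fᵢ` -/

variable (F d X) in
/-- Left multiplication by `f₁`. -/
def F₁ : Module.End F (Induced d X) := lift d fun w s l => mono F d (w + 1) s l

variable (d X) in
/-- The vectors `f₂ f₁ʷ f₃ˢ f₂ˡ ⊗ x`, expanded by means of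
`f₂ f₁ʷ = qʷ f₁ʷ f₂ + [w] f₁ʷ⁻¹ f₃` and `f₂ f₃ = -q f₃ f₂`. -/
def f₂Mono (w : ℕ) : Fin 2 → Fin 2 → X →ₗ[F] Induced d X
  | 0, 0 => q ^ w • mono F d w 0 1 + qInt q w • mono F d (w - 1) 1 0
  | 0, 1 => qInt q w • mono F d (w - 1) 1 1
  | 1, 0 => -q ^ (w + 1) • mono F d w 1 1
  | 1, 1 => 0

variable (d X) in
/-- Left multiplication by `f₂`. -/
def F₂ : Module.End F (Induced d X) := lift d (f₂Mono q d X)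

@[simp]
theorem F₁_mono (w : ℕ) (s l : Fin 2) (x : X) :
    F₁ F d X (mono F d w s l x) = mono F d (w + 1) s l x :=
  lift_mono (fun _ _ _ h => mono_of_le (Nat.le_succ_of_le h) _ _) _ _ _ _

theorem F₁_pow_mono (n w : ℕ) (s l : Fin 2) (x : X) :
    (F₁ F d X ^ n) (mono F d w s l x) = mono F d (w + n) s l x := by
  induction n with
  | zero => simp
  | succ n ih => rw [pow_succ', Module.End.mul_apply, ih, F₁_mono, add_assoc]

variable {q}

@[simp]
theorem qInt_zero : qInt q 0 = 0 := by
  simp [qInt]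

theorem qInt_smul_mono_of_le (hq : q ^ d = 1) {w : ℕ} (h : d ≤ w) (s l : Fin 2) :
    qInt q w • mono F d (X := X) (w - 1) s l = 0 := by
  rcases h.eq_or_lt with rfl | h
  · rw [qInt, hq, inv_one, sub_self, zero_div, zero_smul]
  · rw [mono_of_le (Nat.le_sub_one_of_lt h), smul_zero]

theorem F₂_mono (hq : q ^ d = 1) (w : ℕ) (s l : Fin 2) (x : X) :
    F₂ q d X (mono F d w s l x) = f₂Mono q d X w s l x := by
  refine lift_mono (fun w s l h => ?_) w s l x
  fin_cases s <;> fin_cases l <;> simp [f₂Mono, mono_of_le h, qInt_smul_mono_of_le hq h]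

theorem F₂_sq (hq : q ^ d = 1) : F₂ q d X ^ 2 = 0 := by
  refine hom_ext fun w s l x => ?_
  rw [pow_two, Module.End.mul_apply]
  fin_cases s <;> fin_cases l <;> rcases w with _ | w <;>
    simp only [Fin.zero_eta, Fin.mk_one, F₂_mono hq, f₂Mono, qInt, Nat.add_sub_cancel, map_add,
      map_smul, map_zero, LinearMap.add_apply, LinearMap.smul_apply, LinearMap.zero_apply] <;>
    match_scalars <;> ring

theorem serre_F₁_F₂ (hq : q ^ d = 1) (hq0 : q ≠ 0) :
    serre q (F₁ F d X) (F₂ q d X) = 0 := by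
  refine hom_ext fun w s l x => ?_
  fin_cases s <;> fin_cases l <;> rcases w with _ | w <;>
    simp only [serre, pow_two, Module.End.mul_apply, Fin.zero_eta, Fin.mk_one, F₁_mono, F₂_mono hq,
      f₂Mono, qInt, zero_add, Nat.add_sub_cancel, map_add, map_smul, map_zero,
      LinearMap.add_apply, LinearMap.sub_apply, LinearMap.smul_apply, LinearMap.zero_apply] <;>
    match_scalars <;> field_simp <;> ring

variable (X) in
theorem isSerrePair (hq : q ^ d = 1) (hq0 : q ≠ 0) :
    IsSerrePair q (F₁ F d X) (F₂ q d X) d where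
  pow_eq_zero := hom_ext fun w s l x => by
    rw [F₁_pow_mono, mono_of_le (Nat.le_add_left d w), LinearMap.zero_apply, LinearMap.zero_apply]
  sq_eq_zero := F₂_sq hq
  serre_eq_zero := serre_F₁_F₂ hq hq0

theorem serreMonomial_mono (hq : q ^ d = 1) (hq1 : q - q⁻¹ ≠ 0) (w : ℕ) (s l : Fin 2)
    (x : X) : serreMonomial q (F₁ F d X) (F₂ q d X) w s l (mono F d 0 0 0 x) =
      mono F d w s l x := by
  fin_cases s <;> fin_cases l <;>
    simp [serreMonomial, rootVector, F₁_pow_mono, F₂_mono hq, f₂Mono, qInt, hq1]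

/-- An operator that commutes up to scalars with `f₁` and `f₂` is determined by its values on the
generating vectors. -/
theorem end_eq_zero (hq : q ^ d = 1) (hq1 : q - q⁻¹ ≠ 0)
    {T : Module.End F (Induced d X)} {a b : F} (h₁ : T * F₁ F d X = a • (F₁ F d X * T))
    (h₂ : T * F₂ q d X = b • (F₂ q d X * T)) (h₀ : ∀ x, T (mono F d 0 0 0 x) = 0) : T = 0 :=
  hom_ext fun w s l x => by
    rw [← serreMonomial_mono hq hq1, serreMonomial_apply_of_forall_apply
      (LinearMap.congr_fun h₁) (LinearMap.congr_fun h₂), h₀, map_zero, smul_zero,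
      LinearMap.zero_apply]

/-! ### The action of the `kᵢ` -/

variable (d) in
/-- The operator `f₁ʷ f₃ˢ f₂ˡ ⊗ x ↦ aʷ (a b)ˢ bˡ f₁ʷ f₃ˢ f₂ˡ ⊗ t x`, which is the action of `kᵢ`
if `kᵢ` acts on `X` by `t`, and `a` and `b` are the scalars that appear when `kᵢ` is moved past `f₁`
and `f₂`. -/
def scale (a b : F) (t : Module.End F X) : Module.End F (Induced d X) :=
  lift d fun w s l => (a ^ w * (a * b) ^ (s : ℕ) * b ^ (l : ℕ)) • mono F d w s l ∘ₗ t

theorem scale_mono (a b : F) (t : Module.End F X) (w : ℕ) (s l : Fin 2) (x : X) :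
    scale d a b t (mono F d w s l x) =
      (a ^ w * (a * b) ^ (s : ℕ) * b ^ (l : ℕ)) • mono F d w s l (t x) :=
  lift_mono (fun w s l h => by rw [mono_of_le h, LinearMap.zero_comp, smul_zero]) w s l x

variable (d) in
/-- The operators `scale d a b t` with invertible `a`, `b` and `t`. Being a homomorphism in
`(a, b, t)`, they inherit inverses, commutation and finite order from the scalars and from `t`. -/
def torus : Fˣ × Fˣ × (Module.End F X)ˣ →* (Module.End F (Induced d X))ˣ :=
  MonoidHom.toHomUnits
    { toFun := fun c => scale d c.1 c.2.1 c.2.2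
      map_one' := hom_ext fun w s l x => by simp [scale_mono]
      map_mul' := fun c c' => hom_ext fun w s l x => by
        simp only [Module.End.mul_apply, scale_mono, map_smul, smul_smul, Prod.fst_mul,
          Prod.snd_mul, Units.val_mul]
        ring_nf }

theorem torus_mono (a b : Fˣ) (t : (Module.End F X)ˣ) (w : ℕ) (s l : Fin 2) (x : X) :
    (torus d (a, b, t)).1 (mono F d w s l x) =
      (a ^ w * (a * b) ^ (s : ℕ) * b ^ (l : ℕ) : F) • mono F d w s l (t.1 x) :=
  scale_mono _ _ _ _ _ _ _

theorem torus_inv_mono (a b : Fˣ) (t : (Module.End F X)ˣ) (w : ℕ) (s l : Fin 2) (x : X) :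
    (torus d (a, b, t))⁻¹.1 (mono F d w s l x) =
      ((a : F)⁻¹ ^ w * ((a : F)⁻¹ * (b : F)⁻¹) ^ (s : ℕ) * (b : F)⁻¹ ^ (l : ℕ)) •
        mono F d w s l (t⁻¹.1 x) := by
  rw [← map_inv, Prod.inv_mk, Prod.inv_mk, torus_mono, Units.val_inv_eq_inv_val,
    Units.val_inv_eq_inv_val]

theorem torus_mul_F₁ (a b : Fˣ) (t : (Module.End F X)ˣ) :
    (torus d (a, b, t)).1 * F₁ F d X = (a : F) • (F₁ F d X * (torus d (a, b, t)).1) := by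
  refine hom_ext fun w s l x => ?_
  simp only [Module.End.mul_apply, LinearMap.smul_apply, F₁_mono, torus_mono, map_smul, smul_smul]
  ring_nf

theorem torus_mul_F₂ (hq : q ^ d = 1) (a b : Fˣ) (t : (Module.End F X)ˣ) :
    (torus d (a, b, t)).1 * F₂ q d X = (b : F) • (F₂ q d X * (torus d (a, b, t)).1) := by
  refine hom_ext fun w s l x => ?_
  fin_cases s <;> fin_cases l <;> rcases w with _ | w <;>
    simp only [Module.End.mul_apply, Fin.zero_eta, Fin.mk_one, Fin.val_zero, Fin.val_one,
      F₂_mono hq, f₂Mono, torus_mono, qInt, Nat.add_sub_cancel, map_add, map_smul, map_zero,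
      LinearMap.add_apply, LinearMap.smul_apply, LinearMap.zero_apply] <;>
    match_scalars <;> ring

end Induced

/-! ### The action of the `eᵢ` -/

namespace BorelData

open Induced

variable {q d X} (B : BorelData q (Module.End F X))

variable (d) in
/-- The vectors `e₂ f₁ʷ f₃ˢ f₂ˡ ⊗ x`, expanded by means of `e₂ f₃ = -f₃ e₂ + f₁ k₂⁻¹`. -/
def e₂Mono (w : ℕ) : Fin 2 → Fin 2 → X →ₗ[F] Induced d X
  | 0, 0 => mono F d w 0 0 ∘ₗ B.e₂
  | 0, 1 => -mono F d w 0 1 ∘ₗ B.e₂ + (q - q⁻¹)⁻¹ • mono F d w 0 0 ∘ₗ (B.k₂.1 - B.k₂⁻¹.1)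
  | 1, 0 => -mono F d w 1 0 ∘ₗ B.e₂ + mono F d (w + 1) 0 0 ∘ₗ B.k₂⁻¹.1
  | 1, 1 => mono F d w 1 1 ∘ₗ B.e₂ - (q - q⁻¹)⁻¹ • mono F d w 1 0 ∘ₗ (B.k₂.1 - B.k₂⁻¹.1) +
      mono F d (w + 1) 0 1 ∘ₗ B.k₂⁻¹.1

variable (d) in
/-- The action of `e₁` on the induced module. The vectors `e₁ f₁ʷ f₃ˢ f₂ˡ ⊗ x` are expanded by means
of `e₁ f₃ = f₃ e₁ - q f₂ k₁` and
`e₁ f₁ʷ = f₁ʷ e₁ + [w] f₁ʷ⁻¹ (q¹⁻ʷ k₁ - qʷ⁻¹ k₁⁻¹) / (q - q⁻¹)`. -/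
def inducedE₁ : Module.End F (Induced d X) := Induced.lift d fun w s l =>
  mono F d w s l ∘ₗ B.e₁ +
    (q - q⁻¹)⁻¹ • (qInt q w • mono F d (w - 1) s l) ∘ₗ
      ((q * q⁻¹ ^ w * q⁻¹ ^ (s : ℕ) * q ^ (l : ℕ)) • B.k₁.1 -
        (q⁻¹ * q ^ w * q ^ (s : ℕ) * q⁻¹ ^ (l : ℕ)) • B.k₁⁻¹.1) -
    (if s = 1 ∧ l = 0 then q else 0) • mono F d w 0 1 ∘ₗ B.k₁.1

variable (d) in
/-- The action of `e₂` on the induced module. -/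
def inducedE₂ : Module.End F (Induced d X) := Induced.lift d (B.e₂Mono d)

theorem inducedE₁_mono (hq : q ^ d = 1) (w : ℕ) (s l : Fin 2) (x : X) :
    B.inducedE₁ d (mono F d w s l x) = mono F d w s l (B.e₁ x) +
      (q - q⁻¹)⁻¹ • qInt q w • mono F d (w - 1) s l
        ((q * q⁻¹ ^ w * q⁻¹ ^ (s : ℕ) * q ^ (l : ℕ)) • B.k₁.1 x -
          (q⁻¹ * q ^ w * q ^ (s : ℕ) * q⁻¹ ^ (l : ℕ)) • B.k₁⁻¹.1 x) -
      (if s = 1 ∧ l = 0 then q else 0) • mono F d w 0 1 (B.k₁.1 x) :=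
  lift_mono (fun w s l h => by simp [mono_of_le h, qInt_smul_mono_of_le hq h]) w s l x

theorem inducedE₂_mono (w : ℕ) (s l : Fin 2) (x : X) :
    B.inducedE₂ d (mono F d w s l x) = B.e₂Mono d w s l x :=
  lift_mono (fun w s l h => by
    fin_cases s <;> fin_cases l <;>
      simp [e₂Mono, mono_of_le h, mono_of_le (Nat.le_succ_of_le h)]) w s l x

theorem inducedE₁_mul_torus (hq : q ^ d = 1) {a b : Fˣ} {t : (Module.End F X)ˣ}
    (ht : B.e₁ * t = (a : F) • (t * B.e₁)) (htk : Commute t B.k₁) :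
    B.inducedE₁ d * (torus d (a, b, t)).1 = (a : F) • ((torus d (a, b, t)).1 * B.inducedE₁ d) := by
  have ht' (x : X) : B.e₁ (t.1 x) = (a : F) • t.1 (B.e₁ x) := LinearMap.congr_fun ht x
  have htk' (x : X) : B.k₁.1 (t.1 x) = t.1 (B.k₁.1 x) :=
    LinearMap.congr_fun (congrArg Units.val htk.symm.eq) x
  have htk'' (x : X) : B.k₁⁻¹.1 (t.1 x) = t.1 (B.k₁⁻¹.1 x) :=
    LinearMap.congr_fun (congrArg Units.val htk.inv_right.symm.eq) x
  refine hom_ext fun w s l x => ?_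
  simp only [Module.End.mul_apply, LinearMap.smul_apply, B.inducedE₁_mono hq, torus_mono, ht', htk',
    htk'', map_add, map_sub, map_smul]
  fin_cases s <;> fin_cases l <;> rcases w with _ | w <;>
    simp only [Fin.zero_eta, Fin.mk_one, Fin.val_zero, Fin.val_one, qInt_zero, Nat.add_sub_cancel,
      zero_ne_one, one_ne_zero, and_true, and_false, and_self, ↓reduceIte] <;>
    match_scalars <;> ring

theorem inducedE₂_mul_torus {a b : Fˣ} {t : (Module.End F X)ˣ}
    (ht : B.e₂ * t = (b : F) • (t * B.e₂)) (htk : Commute t B.k₂) :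
    B.inducedE₂ d * (torus d (a, b, t)).1 = (b : F) • ((torus d (a, b, t)).1 * B.inducedE₂ d) := by
  have ht' (x : X) : B.e₂ (t.1 x) = (b : F) • t.1 (B.e₂ x) := LinearMap.congr_fun ht x
  have htk' (x : X) : B.k₂.1 (t.1 x) = t.1 (B.k₂.1 x) :=
    LinearMap.congr_fun (congrArg Units.val htk.symm.eq) x
  have htk'' (x : X) : B.k₂⁻¹.1 (t.1 x) = t.1 (B.k₂⁻¹.1 x) :=
    LinearMap.congr_fun (congrArg Units.val htk.inv_right.symm.eq) x
  refine hom_ext fun w s l x => ?_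
  fin_cases s <;> fin_cases l <;>
    simp only [Module.End.mul_apply, Fin.zero_eta, Fin.mk_one, Fin.val_zero, Fin.val_one,
      inducedE₂_mono, e₂Mono, torus_mono, ht', htk', htk'', map_add, map_sub, map_neg, map_smul,
      LinearMap.comp_apply, LinearMap.add_apply, LinearMap.sub_apply, LinearMap.neg_apply,
      LinearMap.smul_apply] <;>
    match_scalars <;> ring

theorem inducedE₁_mul_F₁ (hq : q ^ d = 1) (hq0 : q ≠ 0) {a b : Fˣ}
    (ha : (a : F) = q⁻¹ ^ 2) (hb : (b : F) = q) :
    B.inducedE₁ d * F₁ F d X = F₁ F d X * B.inducedE₁ d + (q - q⁻¹)⁻¹ •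
      ((torus d (a, b, B.k₁)).1 - (torus d (a, b, B.k₁))⁻¹.1) := by
  refine hom_ext fun w s l x => ?_
  simp only [Module.End.mul_apply, LinearMap.add_apply, LinearMap.sub_apply, LinearMap.smul_apply,
    B.inducedE₁_mono hq, F₁_mono, torus_mono, torus_inv_mono, ha, hb, map_add, map_sub, map_smul]
  fin_cases s <;> fin_cases l <;> rcases w with _ | w <;>
    simp only [Fin.zero_eta, Fin.mk_one, qInt, Nat.add_sub_cancel, inv_pow, zero_add, zero_ne_one,
      one_ne_zero, and_true, and_false, and_self, ↓reduceIte] <;>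
    match_scalars <;> field_simp <;> ring

theorem inducedE₂_mul_F₂ (hq : q ^ d = 1) (hq0 : q ≠ 0) {a : Fˣ}
    (ha : (a : F) = q) :
    B.inducedE₂ d * F₂ q d X = -(F₂ q d X * B.inducedE₂ d) + (q - q⁻¹)⁻¹ •
      ((torus d (a, 1, B.k₂)).1 - (torus d (a, 1, B.k₂))⁻¹.1) := by
  refine hom_ext fun w s l x => ?_
  fin_cases s <;> fin_cases l <;> rcases w with _ | w <;>
    simp only [Module.End.mul_apply, Fin.zero_eta, Fin.mk_one, Fin.val_zero, Fin.val_one,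
      inducedE₂_mono, e₂Mono, F₂_mono hq, f₂Mono, torus_mono, torus_inv_mono, ha, Units.val_one,
      qInt, inv_pow, zero_add, Nat.add_sub_cancel, map_add, map_sub, map_neg, map_smul, map_zero,
      LinearMap.comp_apply, LinearMap.add_apply, LinearMap.sub_apply, LinearMap.neg_apply,
      LinearMap.smul_apply, LinearMap.zero_apply] <;>
    match_scalars <;> field_simp <;> ring

theorem inducedE₁_mul_F₂ (hq : q ^ d = 1) (hq0 : q ≠ 0) :
    B.inducedE₁ d * F₂ q d X = F₂ q d X * B.inducedE₁ d := by
  refine hom_ext fun w s l x => ?_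
  fin_cases s <;> fin_cases l <;> rcases w with _ | _ | w <;>
    simp only [Module.End.mul_apply, Fin.zero_eta, Fin.mk_one, Fin.val_zero, Fin.val_one,
      B.inducedE₁_mono hq, F₂_mono hq, f₂Mono, qInt, inv_pow, zero_add, Nat.add_sub_cancel, map_add,
      map_sub, map_smul, map_zero, LinearMap.add_apply, LinearMap.smul_apply,
      LinearMap.zero_apply, zero_ne_one, one_ne_zero, and_true, and_false, and_self,
      ↓reduceIte] <;>
    match_scalars <;> field_simp <;> ring

theorem inducedE₂_mul_F₁ : B.inducedE₂ d * F₁ F d X = F₁ F d X * B.inducedE₂ d := by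
  refine hom_ext fun w s l x => ?_
  fin_cases s <;> fin_cases l <;> simp [inducedE₂_mono, e₂Mono]

theorem inducedE₁_mono_zero (hq : q ^ d = 1) (x : X) :
    B.inducedE₁ d (mono F d 0 0 0 x) = mono F d 0 0 0 (B.e₁ x) := by
  simp [B.inducedE₁_mono hq]

theorem inducedE₂_mono_zero (x : X) :
    B.inducedE₂ d (mono F d 0 0 0 x) = mono F d 0 0 0 (B.e₂ x) :=
  B.inducedE₂_mono _ _ _ _

/-- The operators on the induced module. -/
def induced (hq : q ^ d = 1) (hq0 : q ≠ 0) : PreRealization q (Module.End F (Induced d X)) where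
  k₁ := torus d ((Units.mk0 q hq0)⁻¹ ^ 2, Units.mk0 q hq0, B.k₁)
  k₂ := torus d (Units.mk0 q hq0, 1, B.k₂)
  e₁ := B.inducedE₁ d
  e₂ := B.inducedE₂ d
  f₁ := F₁ F d X
  f₂ := F₂ q d X
  k₁_k₂ := (Commute.prod (Commute.all _ _)
    (Commute.prod (Commute.all _ _) B.k₁_k₂)).map (torus d)
  e₁_k₁ := B.inducedE₁_mul_torus hq B.e₁_k₁ (Commute.refl B.k₁)
  e₂_k₁ := B.inducedE₂_mul_torus B.e₂_k₁ B.k₁_k₂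
  e₁_k₂ := B.inducedE₁_mul_torus hq B.e₁_k₂ B.k₁_k₂.symm
  e₂_k₂ := (B.inducedE₂_mul_torus (B.e₂_k₂.trans (one_smul F _).symm) (Commute.refl B.k₂)).trans
    (one_smul F _)
  k₁_f₁ := torus_mul_F₁ _ _ _
  k₁_f₂ := torus_mul_F₂ hq _ _ _
  k₂_f₁ := torus_mul_F₁ _ _ _
  k₂_f₂ := (torus_mul_F₂ hq _ _ _).trans (one_smul F _)
  e₁_f₁ := B.inducedE₁_mul_F₁ hq hq0 (by simp) rfl
  e₂_f₂ := B.inducedE₂_mul_F₂ hq hq0 rfl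
  e₁_f₂ := B.inducedE₁_mul_F₂ hq hq0
  e₂_f₁ := B.inducedE₂_mul_F₁

end BorelData

namespace BorelRealization

open Induced

variable {q d X} (B : BorelRealization q d (Module.End F X))

/-- The left-hand sides of the relations commute up to sign with `f₁` and `f₂`, and they kill the
generating vectors because they vanish on `X`. -/
theorem isSerrePair_induced (hd : 1 < d) (hq : q ^ d = 1) (hq0 : q ≠ 0)
    (hq2 : IsPrimitiveRoot (q ^ 2) d) : IsSerrePair q (B.inducedE₁ d) (B.inducedE₂ d) d := by
  have hq1 := sub_inv_ne_zero hd hq0 hq2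
  let R := B.toBorelData.induced hq hq0
  have h₁ (x : X) : mono F d 0 0 0 (B.e₁ x) = (1 : F) • B.inducedE₁ d (mono F d 0 0 0 x) := by
    rw [one_smul, B.inducedE₁_mono_zero hq]
  have h₂ (x : X) : mono F d 0 0 0 (B.e₂ x) = (1 : F) • B.inducedE₂ d (mono F d 0 0 0 x) := by
    rw [one_smul, B.inducedE₂_mono_zero]
  constructor
  · refine end_eq_zero hq hq1 (a := 1) (b := 1) ?_ ?_ fun x => ?_
    · rw [one_smul]
      exact R.e₁_pow_mul_f₁ hq0 hd hq2
    · rw [one_smul]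
      exact Commute.pow_left R.e₁_f₂ d
    · simpa [B.e_pair.pow_eq_zero] using (pow_apply_of_forall_apply h₁ d x).symm
  · refine end_eq_zero hq hq1 (a := 1) (b := 1) ?_ ?_ fun x => ?_
    · rw [one_smul]
      exact Commute.pow_left R.e₂_f₁ 2
    · rw [one_smul]
      exact R.e₂_sq_mul_f₂
    · simpa [B.e_pair.sq_eq_zero] using (pow_apply_of_forall_apply h₂ 2 x).symm
  · refine end_eq_zero hq hq1 (a := 1) (b := -1) ?_ ?_ fun x => ?_
    · rw [one_smul]
      exact R.serre_mul_f₁ hq0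
    · exact (R.serre_mul_f₂ hq0).trans (neg_one_smul F _).symm
    · simpa [B.e_pair.serre_eq_zero] using (serre_apply_of_forall_apply (q := q) h₁ h₂ x).symm

/-- The action of `Ū_q` on the induced module. -/
def induced (hd : 1 < d) (hq : q ^ d = 1) (hq0 : q ≠ 0) (hq2 : IsPrimitiveRoot (q ^ 2) d) :
    Realization q d (Module.End F (Induced d X)) where
  toPreRealization := B.toBorelData.induced hq hq0
  k₁_pow := by
    have hu : Units.mk0 q hq0 ^ d = 1 := Units.ext hq
    simp [BorelData.induced, ← map_pow, B.k₁_pow, hu, pow_right_comm _ 2 d,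
      ← Prod.one_eq_mk]
  k₂_pow := by
    have hu : Units.mk0 q hq0 ^ d = 1 := Units.ext hq
    simp [BorelData.induced, ← map_pow, B.k₂_pow, hu, ← Prod.one_eq_mk]
  e_pair := B.isSerrePair_induced hd hq hq0 hq2
  f_pair := Induced.isSerrePair X hq hq0

end BorelRealization

end Induced

/-! ### The regular representation of the nonnegative part -/

section Regular

variable {F : Type*} [Field F] {G : Type*} [AddCommGroup G] {Y : Type*} [AddCommGroup Y]
  [Module F Y]

variable (F G Y) in
/-- The action of an abelian group `G` by translation on functions on `G`. -/
def translate : Multiplicative G →* (Module.End F (G → Y))ˣ :=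
  MonoidHom.toHomUnits
    { toFun := fun g => LinearMap.funLeft F Y fun h => h - g.toAdd
      map_one' := LinearMap.ext fun φ => funext fun h => by simp
      map_mul' := fun g g' => LinearMap.ext fun φ => funext fun h => by
        simp [LinearMap.funLeft_apply, sub_sub] }

@[simp]
theorem translate_apply (g : Multiplicative G) (φ : G → Y) (h : G) :
    (translate F G Y g).1 φ h = φ (h - g.toAdd) :=
  rfl

theorem translate_single [DecidableEq G] (g : Multiplicative G) (h : G) (y : Y) :
    (translate F G Y g).1 (Pi.single h y) = Pi.single (h + g.toAdd) y := by
  funext r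
  simp [Pi.single_apply, sub_eq_iff_eq_add]

/-- Pointwise application of an endomorphism, weighted by a character `χ`, so that it commutes with
the translation by `g` up to the factor `χ g`. -/
def weighted (χ : AddChar G F) (e : Module.End F Y) : Module.End F (G → Y) :=
  LinearMap.pi fun g => χ g • e ∘ₗ LinearMap.proj g

theorem weighted_apply (χ : AddChar G F) (e : Module.End F Y) (φ : G → Y) (g : G) :
    weighted χ e φ g = χ g • e (φ g) :=
  rfl

theorem weighted_single_zero [DecidableEq G] (χ : AddChar G F) (e : Module.End F Y) (y : Y) :
    weighted χ e (Pi.single 0 y) = Pi.single 0 (e y) := by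
  funext g
  obtain rfl | hg := eq_or_ne g 0
  · simp [weighted_apply]
  · simp [weighted_apply, hg]

theorem weighted_mul_translate (χ : AddChar G F) (e : Module.End F Y) (g : Multiplicative G) :
    weighted χ e * (translate F G Y g).1 =
      χ g.toAdd • ((translate F G Y g).1 * weighted χ e) :=
  LinearMap.ext fun φ => funext fun h => by
    simp only [Module.End.mul_apply, weighted_apply, translate_apply, LinearMap.smul_apply,
      Pi.smul_apply, smul_smul, ← AddChar.map_add_eq_mul, add_sub_cancel]

theorem IsSerrePair.weighted {q : F} {d : ℕ} {a b : Module.End F Y} (h : IsSerrePair q a b d)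
    (χ ψ : AddChar G F) : IsSerrePair q (weighted χ a) (weighted ψ b) d := by
  have hproj (χ : AddChar G F) (e : Module.End F Y) (g : G) (φ : G → Y) :
      LinearMap.proj (R := F) (φ := fun _ : G => Y) g (QuantumSl21.weighted χ e φ) =
        χ g • e (LinearMap.proj (R := F) (φ := fun _ : G => Y) g φ) := rfl
  constructor <;> refine LinearMap.ext fun φ => funext fun g => ?_
  · exact (pow_apply_of_forall_apply (hproj χ a g) d φ).trans (by simp [h.pow_eq_zero])
  · exact (pow_apply_of_forall_apply (hproj ψ b g) 2 φ).trans (by simp [h.sq_eq_zero])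
  · exact (serre_apply_of_forall_apply (hproj χ a g) (hproj ψ b g) φ).trans
      (by simp [h.serre_eq_zero])

variable {d : ℕ} [NeZero d]

/-- The character `(i, j) ↦ aⁱ bʲ` of `(ℤ/d)²`. -/
def torusChar {a b : F} (ha : a ^ d = 1) (hb : b ^ d = 1) : AddChar (ZMod d × ZMod d) F :=
  (AddChar.zmodChar d ha).compAddMonoidHom (AddMonoidHom.fst _ _) *
    (AddChar.zmodChar d hb).compAddMonoidHom (AddMonoidHom.snd _ _)

theorem torusChar_one_zero {a b : F} (ha : a ^ d = 1) (hb : b ^ d = 1) :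
    torusChar ha hb (1, 0) = a := by
  simpa [torusChar] using AddChar.zmodChar_apply' ha 1

theorem torusChar_zero_one {a b : F} (ha : a ^ d = 1) (hb : b ^ d = 1) :
    torusChar ha hb (0, 1) = b := by
  simpa [torusChar] using AddChar.zmodChar_apply' hb 1

/-- The nonnegative part acting on itself: the `kᵢ` act by translations, and the module induced from
the base field, with its operators in the role of the `eᵢ`, supplies the positive part. -/
def borelRegular {q : F} (hq : q ^ d = 1) (hq0 : q ≠ 0) :
    BorelRealization q d (Module.End F (ZMod d × ZMod d → Induced d F)) where
  k₁ := translate F _ _ (.ofAdd (1, 0))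
  k₂ := translate F _ _ (.ofAdd (0, 1))
  e₁ := weighted (torusChar (a := q⁻¹ ^ 2) (b := q) (by rw [pow_right_comm, inv_pow, hq]; simp) hq)
    (Induced.F₁ F d F)
  e₂ := weighted (torusChar hq (one_pow d)) (Induced.F₂ q d F)
  k₁_k₂ := (Commute.all _ _).map (translate F _ _)
  e₁_k₁ := (weighted_mul_translate _ _ _).trans (by rw [toAdd_ofAdd, torusChar_one_zero])
  e₂_k₁ := (weighted_mul_translate _ _ _).trans (by rw [toAdd_ofAdd, torusChar_one_zero])
  e₁_k₂ := (weighted_mul_translate _ _ _).trans (by rw [toAdd_ofAdd, torusChar_zero_one])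
  e₂_k₂ := (weighted_mul_translate _ _ _).trans (by rw [toAdd_ofAdd, torusChar_zero_one, one_smul])
  k₁_pow := by rw [← map_pow, ← ofAdd_nsmul]; simp [← Prod.zero_eq_mk]
  k₂_pow := by rw [← map_pow, ← ofAdd_nsmul]; simp [← Prod.zero_eq_mk]
  e_pair := (Induced.isSerrePair F hq hq0).weighted _ _

end Regular

/-! ### The basis -/

section Basis

open Induced

variable {F : Type*} [Field F] {q : F} {d : ℕ}

theorem BorelRealization.induced_pbw_mono_zero {X : Type*} [AddCommGroup X] [Module F X]
    (B : BorelRealization q d (Module.End F X)) (hd : 1 < d) (hq : q ^ d = 1) (hq0 : q ≠ 0)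
    (hq2 : IsPrimitiveRoot (q ^ 2) d)
    (p : (Fin d × Fin 2 × Fin 2) × (Fin d × Fin d) × Fin d × Fin 2 × Fin 2) (x : X) :
    (B.induced hd hq hq0 hq2).pbw p (mono F d 0 0 0 x) =
      Pi.single p.1 ((B.k₁ ^ (p.2.1.1 : ℕ) * B.k₂ ^ (p.2.1.2 : ℕ)).1
        (serreMonomial q B.e₁ B.e₂ p.2.2.1 p.2.2.2.1 p.2.2.2.2 x)) := by
  set R := B.induced hd hq hq0 hq2
  have hq1 : q - q⁻¹ ≠ 0 := sub_inv_ne_zero hd hq0 hq2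
  have he₁ (x : X) : mono F d 0 0 0 (B.e₁ x) = (1 : F) • R.e₁ (mono F d 0 0 0 x) :=
    (one_smul F _ |>.trans (B.inducedE₁_mono_zero hq x)).symm
  have he₂ (x : X) : mono F d 0 0 0 (B.e₂ x) = (1 : F) • R.e₂ (mono F d 0 0 0 x) :=
    (one_smul F _ |>.trans (B.inducedE₂_mono_zero x)).symm
  have he := serreMonomial_apply_of_forall_apply (q := q) he₁ he₂ p.2.2.1 p.2.2.2.1 p.2.2.2.2 x
  have hk₁ (x : X) : mono F d 0 0 0 (B.k₁.1 x) = (1 : F) • R.k₁.1 (mono F d 0 0 0 x) := by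
    simp [R, induced, BorelData.induced, torus_mono]
  have hk₂ (x : X) : mono F d 0 0 0 (B.k₂.1 x) = (1 : F) • R.k₂.1 (mono F d 0 0 0 x) := by
    simp [R, induced, BorelData.induced, torus_mono]
  have hk (x : X) := (pow_apply_of_forall_apply hk₁ p.2.1.1 ((B.k₂.1 ^ (p.2.1.2 : ℕ)) x)).trans
    (congrArg _ (congrArg _ (pow_apply_of_forall_apply hk₂ p.2.1.2 x)))
  simp only [one_pow, mul_one, one_smul] at he hk
  rw [Realization.pbw, Module.End.mul_apply, Module.End.mul_apply, ← he, Module.End.mul_apply, ← hk,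
    ← mono_val (F := F)]
  exact serreMonomial_mono hq hq1 _ _ _ _

/-- The index type of the Poincaré–Birkhoff–Witt basis, grouped by the factors of the triangular
decomposition. -/
def indexEquiv (d : ℕ) : (Fin d × Fin 2 × Fin 2) × (Fin d × Fin d) × Fin d × Fin 2 × Fin 2 ≃
    Fin d × Fin 2 × Fin 2 × Fin d × Fin d × Fin d × Fin 2 × Fin 2 where
  toFun := fun ((w, s, l), (i, j), r, h, t) => (w, s, l, i, j, r, h, t)
  invFun := fun (w, s, l, i, j, r, h, t) => ((w, s, l), (i, j), r, h, t)

theorem proj_monomial (hq0 : q ≠ 0) (w s l i j r h t : ℕ) :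
    proj F q d (f₁ F q ^ w * f₃ F q ^ s * f₂ F q ^ l * k₁ F q ^ i * k₂ F q ^ j *
        e₁ F q ^ r * e₃ F q ^ h * e₂ F q ^ t) =
      (-q⁻¹) ^ h • (serreMonomial q (tautological F q d).f₁ (tautological F q d).f₂ w s l *
        ((tautological F q d).k₁ ^ i * (tautological F q d).k₂ ^ j) *
          serreMonomial q (tautological F q d).e₁ (tautological F q d).e₂ r h t) := by
  have he₃ : e₃ F q = -q⁻¹ • rootVector q (e₁ F q) (e₂ F q) := by
    rw [e₃, rootVector, smul_sub, smul_smul, neg_mul, inv_mul_cancel₀ hq0]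
    module
  rw [he₃, smul_pow]
  simp only [mul_smul_comm, smul_mul_assoc, map_smul, map_mul, map_pow, mul_assoc, serreMonomial,
    f₃, rootVector, map_sub]
  rfl

theorem natCast_pair_injective : Function.Injective fun i : Fin d × Fin d =>
    (((i.1 : ℕ) : ZMod d), ((i.2 : ℕ) : ZMod d)) :=
  have hcast : Function.Injective fun i : Fin d => ((i : ℕ) : ZMod d) := fun i j h =>
    Fin.ext (CharP.natCast_injOn_Iio (ZMod d) d i.2 j.2 h)
  hcast.prodMap hcast

variable [NeZero d]

theorem borelRegular_monomial_single (hq : q ^ d = 1) (hq0 : q ≠ 0) (hq1 : q - q⁻¹ ≠ 0)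
    (p : (Fin d × Fin d) × Fin d × Fin 2 × Fin 2) :
    ((borelRegular hq hq0).k₁ ^ (p.1.1 : ℕ) * (borelRegular hq hq0).k₂ ^ (p.1.2 : ℕ)).1
        (serreMonomial q (borelRegular hq hq0).e₁ (borelRegular hq hq0).e₂ p.2.1 p.2.2.1 p.2.2.2
          (Pi.single 0 (mono F d 0 0 0 1))) =
      Pi.single (((p.1.1 : ℕ) : ZMod d), ((p.1.2 : ℕ) : ZMod d)) (Pi.single p.2 1) := by
  set B := borelRegular hq hq0 with hB
  have he₁ (y : Induced d F) : LinearMap.single F (fun _ : ZMod d × ZMod d => Induced d F) 0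
      (F₁ F d F y) = (1 : F) • B.e₁ (LinearMap.single F _ 0 y) :=
    (one_smul F _ |>.trans (weighted_single_zero _ _ y)).symm
  have he₂ (y : Induced d F) : LinearMap.single F (fun _ : ZMod d × ZMod d => Induced d F) 0
      (F₂ q d F y) = (1 : F) • B.e₂ (LinearMap.single F _ 0 y) :=
    (one_smul F _ |>.trans (weighted_single_zero _ _ y)).symm
  have he := serreMonomial_apply_of_forall_apply (q := q) he₁ he₂ p.2.1 p.2.2.1 p.2.2.2
    (mono F d 0 0 0 1)
  simp only [one_pow, mul_one, one_smul, LinearMap.single_apply] at he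
  rw [← he, serreMonomial_mono hq hq1, mono_val]
  have hk : B.k₁ ^ (p.1.1 : ℕ) * B.k₂ ^ (p.1.2 : ℕ) = translate F _ _
      (.ofAdd (((p.1.1 : ℕ) : ZMod d), ((p.1.2 : ℕ) : ZMod d))) := by
    simp [hB, borelRegular, ← map_pow, ← map_mul, ← ofAdd_nsmul, ← ofAdd_add]
  rw [hk, translate_single, zero_add, toAdd_ofAdd]

theorem linearIndependent_tautological_pbw (hd : 1 < d) (hq : q ^ d = 1) (hq0 : q ≠ 0)
    (hq2 : IsPrimitiveRoot (q ^ 2) d) : LinearIndependent F (tautological F q d).pbw := by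
  have hq1 : q - q⁻¹ ≠ 0 := sub_inv_ne_zero hd hq0 hq2
  let R := (borelRegular hq hq0).induced hd hq hq0 hq2
  let v : Induced d (ZMod d × ZMod d → Induced d F) :=
    mono F d 0 0 0 (Pi.single 0 (mono F d 0 0 0 1))
  let coord (p : (Fin d × Fin 2 × Fin 2) × (Fin d × Fin d) × Fin d × Fin 2 × Fin 2) :
      UBar F q d →ₗ[F] F :=
    LinearMap.proj p.2.2 ∘ₗ LinearMap.proj (((p.2.1.1 : ℕ) : ZMod d), ((p.2.1.2 : ℕ) : ZMod d)) ∘ₗ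
      LinearMap.proj p.1 ∘ₗ LinearMap.applyₗ v ∘ₗ R.lift.toLinearMap
  have hcoord p p' : coord p ((tautological F q d).pbw p') = if p = p' then 1 else 0 := by
    change (R.lift _ v) _ _ _ = _
    rw [R.lift_tautological_pbw, BorelRealization.induced_pbw_mono_zero,
      borelRegular_monomial_single hq hq0 hq1]
    obtain ⟨p₁, p₂, p₃⟩ := p
    obtain ⟨p₁', p₂', p₃'⟩ := p'
    by_cases h₁ : p₁ = p₁' <;> rcases eq_or_ne p₂ p₂' with rfl | h₂ <;>
      simp [*, Pi.single_apply, natCast_pair_injective.eq_iff' rfl]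
  exact .of_pairwise_dual_eq_zero_one _ coord (fun p p' h => by simp [hcoord, h])
    fun p => by simp [hcoord]

variable (F) in
theorem exists_basis_proj_monomial (hd_odd : Odd d) (hd : 3 ≤ d) (hq : IsPrimitiveRoot q d) :
    ∃ b : Module.Basis
        (Fin d × Fin 2 × Fin 2 × Fin d × Fin d × Fin d × Fin 2 × Fin 2) F (UBar F q d),
      ∀ (w : Fin d) (s l : Fin 2) (i j r : Fin d) (h t : Fin 2),
        b (w, s, l, i, j, r, h, t) =
          proj F q d
            (f₁ F q ^ (w : ℕ) * f₃ F q ^ (s : ℕ) * f₂ F q ^ (l : ℕ) *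
              k₁ F q ^ (i : ℕ) * k₂ F q ^ (j : ℕ) *
              e₁ F q ^ (r : ℕ) * e₃ F q ^ (h : ℕ) * e₂ F q ^ (t : ℕ)) := by
  have hq0 : q ≠ 0 := hq.ne_zero (by omega)
  have hq2 : IsPrimitiveRoot (q ^ 2) d := hq.pow_of_coprime 2 (Nat.coprime_two_left.2 hd_odd)
  have hq4 : q ^ 2 + 1 ≠ 0 := fun h => by
    have h1 : (q ^ 2) ^ 2 = 1 := by linear_combination (q ^ 2 - 1) * h
    have := Nat.le_of_dvd two_pos (hq2.dvd_of_pow_eq_one 2 h1)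
    omega
  let b := Module.Basis.mk (linearIndependent_tautological_pbw (by omega) hq.pow_eq_one hq0 hq2)
    (span_tautological_pbw hq0 hq4)
  let c : Fˣ := Units.mk0 (-q⁻¹) (neg_ne_zero.2 (inv_ne_zero hq0))
  refine ⟨(b.unitsSMul fun p => c ^ (p.2.2.2.1 : ℕ)).reindex (indexEquiv d),
    fun w s l i j r h t => ?_⟩
  rw [proj_monomial hq0, Module.Basis.reindex_apply, Module.Basis.unitsSMul_apply,
    Module.Basis.mk_apply]
  rfl

end Basis

end QuantumSl21

open QuantumSl21 in
theorem mainTheorem6_general (F : Type*) [Field F] (d : ℕ) (hd_odd : Odd d) (hd : 3 ≤ d)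
    (q : F) (hq : IsPrimitiveRoot q d) :
    (∃ b : Module.Basis
        (Fin d × Fin 2 × Fin 2 × Fin d × Fin d × Fin d × Fin 2 × Fin 2) F (UBar F q d),
      ∀ (w : Fin d) (s l : Fin 2) (i j r : Fin d) (h t : Fin 2),
        b (w, s, l, i, j, r, h, t) =
          proj F q d
            (f₁ F q ^ (w : ℕ) * f₃ F q ^ (s : ℕ) * f₂ F q ^ (l : ℕ) *
              k₁ F q ^ (i : ℕ) * k₂ F q ^ (j : ℕ) *
              e₁ F q ^ (r : ℕ) * e₃ F q ^ (h : ℕ) * e₂ F q ^ (t : ℕ))) ∧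
      Module.Finite F (UBar F q d) ∧
      Module.finrank F (UBar F q d) = 16 * d ^ 4 := by
  have : NeZero d := ⟨by omega⟩
  obtain ⟨b, hb⟩ := exists_basis_proj_monomial F hd_odd hd hq
  refine ⟨⟨b, hb⟩, .of_basis b, ?_⟩
  rw [Module.finrank_eq_card_basis b]
  simp only [Fintype.card_prod, Fintype.card_fin]
  ring

open QuantumSl21 in
theorem mainTheorem6 (F : Type*) [Field F] [CharZero F] (d : ℕ) (hd_odd : Odd d) (hd : 3 ≤ d)
    (q : F) (hq : IsPrimitiveRoot q d) :
    (∃ b : Module.Basis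
        (Fin d × Fin 2 × Fin 2 × Fin d × Fin d × Fin d × Fin 2 × Fin 2) F (UBar F q d),
      ∀ (w : Fin d) (s l : Fin 2) (i j r : Fin d) (h t : Fin 2),
        b (w, s, l, i, j, r, h, t) =
          proj F q d
            (f₁ F q ^ (w : ℕ) * f₃ F q ^ (s : ℕ) * f₂ F q ^ (l : ℕ) *
              k₁ F q ^ (i : ℕ) * k₂ F q ^ (j : ℕ) *
              e₁ F q ^ (r : ℕ) * e₃ F q ^ (h : ℕ) * e₂ F q ^ (t : ℕ))) ∧
      Module.Finite F (UBar F q d) ∧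
      Module.finrank F (UBar F q d) = 16 * d ^ 4 :=
  mainTheorem6_general F d hd_odd hd q hq
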